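/- For a finite graph $H$, write $N[v]$ for the closed neighborhood of a vertex $v$. A sequence $S=(v_1,\dots,v_k)$ of distinct vertices of $H$ is a *legal dominating sequence* if $\{v_1,\dots,v_k\}$ is a dominating set of $H$ and $N[v_i]\setminus\bigcup_{j<i}N[v_j]\neq\emptyset$ for every $i\in\{1,\dots,k\}$. A *Grundy dominating sequence* (Gds) of $H$ is a legal dominating sequence of maximum length, and $\gamma_{gr}(H)$ denotes its length. Let $m\ge 1$ and $n\ge 2(m+1)$ be integers, and let $G=C_n^m$ be the $m$-th power of the cycle $C_n$: its vertex set is $[n]=\{1,\dots,n\}$, and two distinct vertices are adjacent if their distance in $C_n$ is at most $m$. Let $\mathcal R=\{G_i : i\in[n]\}$ be a family of nonempty finite graphs, and let $G\hookleftarrow\mathcal R$ be the graph obtained from $G$ by replacing each vertex $i$ by $G_i$: its vertex set is the disjoint union of the sets $V(G_i)$, it contains the edges of every $G_i$, and every vertex of $G_i$ is adjacent to every vertex of $G_j$ whenever $i$ and $j$ are adjacent in $G$. Put $w_i=\gamma_{gr}(G_i)-(m+1)\in\mathbb Z$ for $i\in[n]$ and $w(I)=\sum_{i\in I}w_i$ for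 $I\subseteq[n]$. Let $\alpha_w(C_n^m)$ be the maximum of $w(I)$ over all independent sets $I$ of $C_n^m$ (including $\emptyset$), and let $\alpha_w^2(C_n^m)$ be the maximum of $w(I)$ over all independent sets $I$ of $C_n^m$ with exactly two vertices. **Theorem.** Let $I^*$ be any independent set of $C_n^m$ with $w(I^*)=\alpha_w(C_n^m)$. * If $|I^*|\ge 2$, then $\gamma_{gr}(G\hookleftarrow\mathcal R)=\alpha_w(C_n^m)+n$. * If $|I^*|\le 1$, then $\gamma_{gr}(G\hookleftarrow\mathcal R)=\alpha_w^2(C_n^m)+n$. Moreover, there is a polynomial-time algorithm which, given $n$, $m$ and a Gds $S_i$ of $G_i$ for each $i\in[n]$ (where $m$, $n$ and the $G_i$ are as above), outputs a Gds of $G\hookleftarrow\mathcal R$. The running time is polynomial in the bit length of the input $(n,m,S_1,\dots,S_n)$. -/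

import Mathlib

/-! ### Graphs -/

/-- The `m`-th power of `G`: distinct vertices are adjacent when their distance in `G` is at
most `m` (`edist` is `⊤` between different components). -/
def graphPower {V : Type*} (G : SimpleGraph V) (m : ℕ) : SimpleGraph V where
  Adj u v := u ≠ v ∧ G.edist u v ≤ (m : ℕ∞)
  symm := ⟨fun _ _ h => ⟨h.1.symm, by rw [SimpleGraph.edist_comm]; exact h.2⟩⟩
  loopless := ⟨fun _ h => h.1 rfl⟩

/-- The power of a cycle `C_n^m`, on the vertex set `{0, …, n - 1}`. -/
def cyclePower (n m : ℕ) : SimpleGraph (Fin n) :=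
  graphPower (SimpleGraph.cycleGraph n) m

/-- The `X`-join product `G ↩ R`: every vertex `v` of `G` is replaced by the graph `R v`. -/
def xJoin {V : Type*} {W : V → Type*} (G : SimpleGraph V) (R : ∀ v, SimpleGraph (W v)) :
    SimpleGraph (Σ v, W v) where
  Adj a b := G.Adj a.1 b.1 ∨ ∃ (v : V) (x y : W v), (R v).Adj x y ∧ a = ⟨v, x⟩ ∧ b = ⟨v, y⟩
  symm := ⟨by
    rintro a b (h | ⟨v, x, y, h, ha, hb⟩)
    · exact Or.inl h.symm
    · exact Or.inr ⟨v, y, x, h.symm, hb, ha⟩⟩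
  loopless := ⟨by
    rintro a (h | ⟨v, x, y, h, ha, hb⟩)
    · exact h.ne rfl
    · subst ha
      obtain rfl : x = y := by simpa using hb
      exact h.ne rfl⟩

/-- The closed neighborhood `N[v]`. -/
def closedNbhd {V : Type*} (G : SimpleGraph V) (v : V) : Set V :=
  insert v (G.neighborSet v)

/-- The private neighborhood of the `i`-th entry of the sequence `S`: its closed neighborhood
minus the closed neighborhoods of all earlier entries. -/
def privateNbhd {V : Type*} (G : SimpleGraph V) (S : List V) (i : Fin S.length) : Set V :=
  closedNbhd G (S.get i) \ ⋃ j : Fin S.length, ⋃ _ : j < i, closedNbhd G (S.get j)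

/-- Legal dominating sequences of `G`. -/
def IsLegalDomSeq {V : Type*} (G : SimpleGraph V) (S : List V) : Prop :=
  S.Nodup ∧ (∀ v, ∃ u ∈ S, u ∈ closedNbhd G v) ∧ ∀ i, (privateNbhd G S i).Nonempty

/-- Grundy dominating sequences: legal dominating sequences of maximum length. -/
def IsGds {V : Type*} (G : SimpleGraph V) (S : List V) : Prop :=
  IsLegalDomSeq G S ∧ ∀ T, IsLegalDomSeq G T → T.length ≤ S.length

/-- The Grundy domination number `γ_gr(G)` (used for finite graphs only, where this is the
supremum of a nonempty bounded set). -/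
noncomputable def grundyNumber {V : Type*} (G : SimpleGraph V) : ℕ :=
  sSup {k | ∃ S, IsLegalDomSeq G S ∧ S.length = k}

/-- `α_w(G)`, the maximum weight of an independent set of a finite graph. -/
noncomputable def alphaWeight {V : Type*} (G : SimpleGraph V) (w : V → ℤ) : ℤ :=
  sSup {x | ∃ I : Finset V, G.IsIndepSet ↑I ∧ x = ∑ i ∈ I, w i}

/-- `α²_w(G)`, the maximum weight of an independent set with exactly two vertices of a finite
graph that has such a set. -/
noncomputable def alphaWeightTwo {V : Type*} (G : SimpleGraph V) (w : V → ℤ) : ℤ :=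
  sSup {x | ∃ I : Finset V, G.IsIndepSet ↑I ∧ I.card = 2 ∧ x = ∑ i ∈ I, w i}

/-! ### Random access programs and polynomial time

Programs over natural-number variables `x₀, x₁, …` and arrays `A₀, A₁, …`, with addition and
truncated subtraction as the only arithmetic operations. Every operation takes one step. As in
the usual random access machine with addition and subtraction, a step increases the bit length
of the stored numbers by at most one, so that polynomially many steps are the same as polynomial
time on a Turing machine. -/

/-- A memory state: the values of the variables and the contents of the arrays. -/
structure RamState where
  var : ℕ → ℕ
  arr : ℕ → ℕ → ℕ

inductive RamExpr where
  | const (k : ℕ)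
  | var (x : ℕ)
  /-- the entry of the array `a` at the address given by `e` -/
  | read (a : ℕ) (e : RamExpr)
  | add (e f : RamExpr)
  | sub (e f : RamExpr)

def RamExpr.eval (s : RamState) : RamExpr → ℕ
  | .const k => k
  | .var x => s.var x
  | .read a e => s.arr a (e.eval s)
  | .add e f => e.eval s + f.eval s
  | .sub e f => e.eval s - f.eval s

/-- The number of steps to evaluate an expression: one for each of its nodes. -/
def RamExpr.cost : RamExpr → ℕ
  | .const _ => 1
  | .var _ => 1
  | .read _ e => e.cost + 1
  | .add e f => e.cost + f.cost + 1
  | .sub e f => e.cost + f.cost + 1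

inductive RamProg where
  | skip
  /-- `x := e` -/
  | assign (x : ℕ) (e : RamExpr)
  /-- `A_a[e] := f` -/
  | write (a : ℕ) (e f : RamExpr)
  | seq (p q : RamProg)
  /-- if `e ≠ 0` then `p` else `q` -/
  | cond (e : RamExpr) (p q : RamProg)
  /-- while `e ≠ 0` do `p` -/
  | loop (e : RamExpr) (p : RamProg)

/-- `RamExec p s s' t`: the program `p`, started in the state `s`, halts in the state `s'` after
exactly `t` steps. -/
inductive RamExec : RamProg → RamState → RamState → ℕ → Prop where
  | skip (s : RamState) : RamExec .skip s s 1
  | assign (s : RamState) (x : ℕ) (e : RamExpr) :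
      RamExec (.assign x e) s ⟨Function.update s.var x (e.eval s), s.arr⟩ (e.cost + 1)
  | write (s : RamState) (a : ℕ) (e f : RamExpr) :
      RamExec (.write a e f) s
        ⟨s.var, Function.update s.arr a (Function.update (s.arr a) (e.eval s) (f.eval s))⟩
        (e.cost + f.cost + 1)
  | seq {p q : RamProg} {s₁ s₂ s₃ : RamState} {t₁ t₂ : ℕ} :
      RamExec p s₁ s₂ t₁ → RamExec q s₂ s₃ t₂ → RamExec (.seq p q) s₁ s₃ (t₁ + t₂)
  | condTrue {e : RamExpr} {p q : RamProg} {s s' : RamState} {t : ℕ} :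
      e.eval s ≠ 0 → RamExec p s s' t → RamExec (.cond e p q) s s' (e.cost + 1 + t)
  | condFalse {e : RamExpr} {p q : RamProg} {s s' : RamState} {t : ℕ} :
      e.eval s = 0 → RamExec q s s' t → RamExec (.cond e p q) s s' (e.cost + 1 + t)
  | loopDone {e : RamExpr} {p : RamProg} {s : RamState} :
      e.eval s = 0 → RamExec (.loop e p) s s (e.cost + 1)
  | loopStep {e : RamExpr} {p : RamProg} {s₁ s₂ s₃ : RamState} {t₁ t₂ : ℕ} :
      e.eval s₁ ≠ 0 → RamExec p s₁ s₂ t₁ → RamExec (.loop e p) s₂ s₃ t₂ →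
      RamExec (.loop e p) s₁ s₃ (e.cost + 1 + t₁ + t₂)

/-- The initial state: the input is in the array `A₀`, its length in `x₀`, all else is `0`. -/
def ramInit (l : List ℕ) : RamState where
  var := fun x => if x = 0 then l.length else 0
  arr := fun a j => if a = 0 then l.getD j 0 else 0

/-- The output: the first `x₁` entries of the array `A₁`. -/
def ramOutput (s : RamState) : List ℕ :=
  (List.range (s.var 1)).map (s.arr 1)

/-- The bit length of an input, with one separator for each number. -/
def bitLength (l : List ℕ) : ℕ :=
  (l.map fun x => x.size + 1).sum

/-- The search problem with instances `x : ι`, presented to the program as `encode x`, in which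
any list `out` with `IsSolution x out` may be returned, is solved by one program in polynomial
time. -/
def PolyTimeSolvable {ι : Type*} (encode : ι → List ℕ) (IsSolution : ι → List ℕ → Prop) : Prop :=
  ∃ (p : RamProg) (b : Polynomial ℕ), ∀ x : ι, ∃ (s : RamState) (t : ℕ),
    RamExec p (ramInit (encode x)) s t ∧ t ≤ b.eval (bitLength (encode x)) ∧
      IsSolution x (ramOutput s)

/-! ### The computational problem -/

/-- An instance: numbers `n`, `m` with `m ≥ 1` and `2(m+1) ≤ n`, nonempty finite graphs
`R 0, …, R (n-1)`, the vertices of each labelled `0, 1, …`, and a Grundy dominating sequence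
`S i` of each `R i`. -/
structure CycleJoinInstance where
  n : ℕ
  m : ℕ
  one_le_m : 1 ≤ m
  le_n : 2 * (m + 1) ≤ n
  order : Fin n → ℕ
  order_pos : ∀ i, 0 < order i
  R : ∀ i, SimpleGraph (Fin (order i))
  S : ∀ i, List (Fin (order i))
  isGds : ∀ i, IsGds (R i) (S i)

/-- The input `n, m, |S 0|, S 0, …, |S (n-1)|, S (n-1)`. The program is given the sequences but
not the edges of the graphs, which makes its task harder and its input shorter. -/
def CycleJoinInstance.encode (x : CycleJoinInstance) : List ℕ :=
  [x.n, x.m] ++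
    (List.finRange x.n).flatMap fun i => (x.S i).length :: (x.S i).map fun v => (v : ℕ)

/-- The graph `C_n^m ↩ R` of an instance. -/
def CycleJoinInstance.graph (x : CycleJoinInstance) :
    SimpleGraph (Σ i : Fin x.n, Fin (x.order i)) :=
  xJoin (cyclePower x.n x.m) x.R

/-- `out` lists a Grundy dominating sequence of `C_n^m ↩ R`, the vertex `v` of `R i` being
written as the two numbers `i, v`. -/
def CycleJoinInstance.IsSolution (x : CycleJoinInstance) (out : List ℕ) : Prop :=
  ∃ T : List (Σ i : Fin x.n, Fin (x.order i)),
    IsGds x.graph T ∧ out = T.flatMap fun a => [(a.1 : ℕ), (a.2 : ℕ)]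

/-! ### Legal sequences and their footprints -/

/-! Upper bound. Along a legal dominating sequence of the join, call a vertex `b` of the cycle power
a root if the first play in `N[b]` is made in the graph at `b` itself. Roots are pairwise
nonadjacent, because the earlier of two adjacent ones would spoil the later. Every play either
footprints something in the graph of a root, or is made off the roots and dominates a fresh vertex,
one whose closed neighborhood was untouched so far (`footprintsIn_or_fresh`). The graph of a root
absorbs at most its Grundy number of plays (`card_footprintsIn_le`). Plays of the second kind are
charged injectively to cycle vertices outside the disjoint arcs of `m + 1` vertices starting at the
roots (`card_freshTimes_le`). So the set `B` of roots gives the bound `w(B) + n`. If there is only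
one root, the fresh vertices even avoid the `2m + 1` vertices dominated by the first play, which
leaves room to add a second vertex to `B`, its Grundy number being at least 1.

Lower bound. Given an independent set `I` with at least two vertices, play the whole sequence at
some `s` in `I`. In offsets from `s`, the undominated part is now an interval, which is consumed
from the left: one offset at a time by single plays, or `m + 1` offsets by the sequence of a member
of `I`. Before the last member is played, the interval behind it is consumed from the right by
single plays, so that nothing is lost at the end. The best such play is a one-dimensional recursion,
`playValue`, and it reaches `w(I) + n` (`sum_le_playValue`, `sum_le_length_fullPlay`).

Hence the Grundy number minus `n` is the maximum weight of an independent set with at least two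
vertices. This is `α_w` if an optimal set has two vertices. Otherwise it is `α²_w`: three positive
weights in one independent set would allow an optimal set with at most one vertex to be enlarged.

Algorithm. Tabulate `playValue` for every start `s`, take a best start and output its play. Its
length is at least the value of every independent set with two or more vertices, so it is optimal by
the upper bound. -/

theorem mem_closedNbhd {V : Type*} {G : SimpleGraph V} {u v : V} :
    u ∈ closedNbhd G v ↔ u = v ∨ G.Adj v u := by
  simp [closedNbhd]

theorem self_mem_closedNbhd {V : Type*} (G : SimpleGraph V) (v : V) : v ∈ closedNbhd G v :=
  mem_closedNbhd.2 (Or.inl rfl)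

theorem mem_closedNbhd_comm {V : Type*} {G : SimpleGraph V} {u v : V} :
    u ∈ closedNbhd G v ↔ v ∈ closedNbhd G u := by
  simp [mem_closedNbhd, eq_comm, G.adj_comm]

theorem mem_privateNbhd {V : Type*} {G : SimpleGraph V} {S : List V} {i : Fin S.length} {x : V} :
    x ∈ privateNbhd G S i ↔
      x ∈ closedNbhd G (S.get i) ∧ ∀ j : Fin S.length, j < i → x ∉ closedNbhd G (S.get j) := by
  simp [privateNbhd]

/-- A list of pairs `(v, x)` in which `x` is a footprint of `v`: it lies in the closed
neighborhood of `v`, but not in that of any earlier vertex. -/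
def IsFootprintList {V : Type*} (G : SimpleGraph V) (P : List (V × V)) : Prop :=
  (∀ p ∈ P, p.2 ∈ closedNbhd G p.1) ∧ P.Pairwise fun p q => q.2 ∉ closedNbhd G p.1

theorem IsFootprintList.isLegalDomSeq {V : Type*} {G : SimpleGraph V} {P : List (V × V)}
    (h : IsFootprintList G P) (hd : ∀ v, ∃ p ∈ P, p.1 ∈ closedNbhd G v) :
    IsLegalDomSeq G (P.map Prod.fst) := by
  refine ⟨?_, ?_, ?_⟩
  · rw [List.Nodup, List.pairwise_map]
    refine List.Pairwise.imp_of_mem ?_ h.2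
    intro p q _ hq hpq heq
    exact hpq (heq ▸ h.1 q hq)
  · intro v
    obtain ⟨p, hp, hv⟩ := hd v
    exact ⟨p.1, List.mem_map_of_mem hp, hv⟩
  · intro i
    have hi : i.1 < P.length := by simpa using i.2
    refine ⟨(P[i.1]).2, mem_privateNbhd.2 ⟨?_, ?_⟩⟩
    · simpa using h.1 _ (List.getElem_mem hi)
    · intro j hj
      have hj' : j.1 < P.length := by simpa using j.2
      simpa using List.pairwise_iff_getElem.1 h.2 j.1 i.1 hj' hi hj

/-- Footprints are pairwise distinct: each one is dominated as soon as its own vertex is played. -/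
theorem IsFootprintList.length_le_card {V : Type*} [Finite V] {G : SimpleGraph V}
    {P : List (V × V)} (h : IsFootprintList G P) : P.length ≤ Nat.card V := by
  classical
  have := Fintype.ofFinite V
  have hn : (P.map Prod.snd).Nodup := by
    rw [List.Nodup, List.pairwise_map]
    refine List.Pairwise.imp_of_mem ?_ h.2
    intro p q hp _ hpq heq
    exact hpq (heq ▸ h.1 p hp)
  rw [Nat.card_eq_fintype_card]
  simpa using hn.length_le_card

/-- As long as some `v` is undominated, `(v, v)` can be appended. Domination therefore never has to
be checked when a footprint list is only used to bound `grundyNumber` from below. -/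
theorem IsFootprintList.exists_isLegalDomSeq {V : Type*} [Finite V] {G : SimpleGraph V}
    {P : List (V × V)} (h : IsFootprintList G P) :
    ∃ S, IsLegalDomSeq G S ∧ P.length ≤ S.length := by
  induction hk : Nat.card V - P.length using Nat.strong_induction_on generalizing P with
  | _ k ih =>
    by_cases hd : ∀ v, ∃ p ∈ P, p.1 ∈ closedNbhd G v
    · exact ⟨_, h.isLegalDomSeq hd, by simp⟩
    · push Not at hd
      obtain ⟨v, hv⟩ := hd
      have h' : IsFootprintList G (P ++ [(v, v)]) := by
        refine ⟨?_, ?_⟩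
        · intro p hp
          rcases List.mem_append.1 hp with hp | hp
          · exact h.1 p hp
          · obtain rfl : p = (v, v) := by simpa using hp
            exact self_mem_closedNbhd G v
        · refine List.pairwise_append.2 ⟨h.2, by simp, ?_⟩
          intro p hp q hq
          obtain rfl : q = (v, v) := by simpa using hq
          exact fun hc => hv p hp (mem_closedNbhd_comm.1 hc)
      have hl := h'.length_le_card
      simp only [List.length_append, List.length_singleton] at hl
      obtain ⟨S, hS, hle⟩ := ih _ (by
        simp only [List.length_append, List.length_singleton]; omega) h' rfl
      refine ⟨S, hS, ?_⟩
      simp only [List.length_append, List.length_singleton] at hle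
      omega

theorem IsLegalDomSeq.length_le_card {V : Type*} [Finite V] {G : SimpleGraph V} {S : List V}
    (h : IsLegalDomSeq G S) : S.length ≤ Nat.card V := by
  classical
  have := Fintype.ofFinite V
  rw [Nat.card_eq_fintype_card]
  exact h.1.length_le_card

theorem IsGds.length_eq {V : Type*} {G : SimpleGraph V} {S : List V} (h : IsGds G S) :
    S.length = grundyNumber G := by
  have hg : IsGreatest {k | ∃ S, IsLegalDomSeq G S ∧ S.length = k} S.length :=
    ⟨⟨S, h.1, rfl⟩, by rintro _ ⟨T, hT, rfl⟩; exact h.2 T hT⟩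
  exact hg.csSup_eq.symm

theorem exists_isGds {V : Type*} [Finite V] (G : SimpleGraph V) : ∃ S, IsGds G S := by
  have hne : {k | ∃ S, IsLegalDomSeq G S ∧ S.length = k}.Nonempty := by
    obtain ⟨S, hS, -⟩ := IsFootprintList.exists_isLegalDomSeq (G := G) (P := []) ⟨by simp, by simp⟩
    exact ⟨_, S, hS, rfl⟩
  have hb : BddAbove {k | ∃ S, IsLegalDomSeq G S ∧ S.length = k} :=
    ⟨Nat.card V, by rintro _ ⟨S, hS, rfl⟩; exact hS.length_le_card⟩
  obtain ⟨S, hS, hl⟩ := Nat.sSup_mem hne hb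
  exact ⟨S, hS, fun T hT => hl ▸ le_csSup hb ⟨T, hT, rfl⟩⟩

theorem IsLegalDomSeq.length_le_grundyNumber {V : Type*} [Finite V] {G : SimpleGraph V}
    {S : List V} (h : IsLegalDomSeq G S) : S.length ≤ grundyNumber G := by
  obtain ⟨T, hT⟩ := exists_isGds G
  exact hT.length_eq ▸ hT.2 S h

theorem IsFootprintList.length_le_grundyNumber {V : Type*} [Finite V] {G : SimpleGraph V}
    {P : List (V × V)} (h : IsFootprintList G P) : P.length ≤ grundyNumber G := by
  obtain ⟨S, hS, hle⟩ := h.exists_isLegalDomSeq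
  exact hle.trans hS.length_le_grundyNumber

theorem one_le_grundyNumber {V : Type*} [Finite V] [Nonempty V] (G : SimpleGraph V) :
    1 ≤ grundyNumber G := by
  obtain ⟨v⟩ := ‹Nonempty V›
  exact IsFootprintList.length_le_grundyNumber (P := [(v, v)])
    ⟨by simp [self_mem_closedNbhd], by simp⟩

/-- `L` is a legal continuation to a dominating sequence when the vertices in `D` are already
dominated. -/
def LegalFrom {V : Type*} (G : SimpleGraph V) : Set V → List V → Prop
  | D, [] => D = Set.univ
  | D, v :: L => (closedNbhd G v \ D).Nonempty ∧ LegalFrom G (D ∪ closedNbhd G v) L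

theorem LegalFrom.exists_footprints {V : Type*} {G : SimpleGraph V} {L : List V} :
    ∀ {D : Set V}, LegalFrom G D L → ∃ P : List (V × V), P.map Prod.fst = L ∧
      IsFootprintList G P ∧ (∀ p ∈ P, p.2 ∉ D) ∧
      ∀ v, v ∈ D ∨ ∃ p ∈ P, p.1 ∈ closedNbhd G v := by
  induction L with
  | nil =>
    intro D h
    refine ⟨[], rfl, ⟨by simp, by simp⟩, by simp, fun v => Or.inl ?_⟩
    rw [show D = Set.univ from h]
    trivial
  | cons u L ih =>
    rintro D ⟨⟨x, hx, hxD⟩, hL⟩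
    obtain ⟨P, hP, hF, hD, hdom⟩ := ih hL
    refine ⟨(u, x) :: P, by simp [hP], ⟨?_, ?_⟩, ?_, ?_⟩
    · intro p hp
      rcases List.mem_cons.1 hp with rfl | hp
      · exact hx
      · exact hF.1 p hp
    · exact List.pairwise_cons.2 ⟨fun q hq hc => hD q hq (Or.inr hc), hF.2⟩
    · intro p hp
      rcases List.mem_cons.1 hp with rfl | hp
      · exact hxD
      · exact fun hc => hD p hp (Or.inl hc)
    · intro v
      rcases hdom v with (hv | hv) | ⟨p, hp, hv⟩
      · exact Or.inl hv
      · exact Or.inr ⟨(u, x), by simp, mem_closedNbhd_comm.1 hv⟩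
      · exact Or.inr ⟨p, by simp [hp], hv⟩

theorem LegalFrom.isLegalDomSeq {V : Type*} {G : SimpleGraph V} {L : List V}
    (h : LegalFrom G ∅ L) : IsLegalDomSeq G L := by
  obtain ⟨P, rfl, hF, -, hdom⟩ := h.exists_footprints
  exact hF.isLegalDomSeq fun v => (hdom v).resolve_left (by simp)

theorem legalFrom_of_private {V : Type*} {G : SimpleGraph V} {L : List V} :
    ∀ {D : Set V}, (∀ i, (privateNbhd G L i \ D).Nonempty) →
      (∀ v, v ∈ D ∨ ∃ u ∈ L, u ∈ closedNbhd G v) → LegalFrom G D L := by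
  induction L with
  | nil =>
    intro D _ hd
    exact Set.eq_univ_of_forall fun v => by simpa using hd v
  | cons u L ih =>
    intro D hp hd
    refine ⟨?_, ih ?_ ?_⟩
    · obtain ⟨x, hx, hxD⟩ := hp ⟨0, by simp⟩
      exact ⟨x, (mem_privateNbhd.1 hx).1, hxD⟩
    · intro i
      obtain ⟨x, hx, hxD⟩ := hp i.succ
      obtain ⟨h1, h2⟩ := mem_privateNbhd.1 hx
      refine ⟨x, mem_privateNbhd.2 ⟨h1, fun j hj => h2 j.succ (Fin.succ_lt_succ_iff.2 hj)⟩, ?_⟩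
      rintro (h | h)
      · exact hxD h
      · exact h2 ⟨0, by simp⟩ (Fin.succ_pos i) h
    · intro v
      rcases hd v with h | ⟨w, hw, hv⟩
      · exact Or.inl (Or.inl h)
      · rcases List.mem_cons.1 hw with rfl | hw
        · exact Or.inl (Or.inr (mem_closedNbhd_comm.1 hv))
        · exact Or.inr ⟨w, hw, hv⟩

theorem IsLegalDomSeq.legalFrom {V : Type*} {G : SimpleGraph V} {L : List V}
    (h : IsLegalDomSeq G L) : LegalFrom G ∅ L :=
  legalFrom_of_private (by simpa using h.2.2) (fun v => Or.inr (h.2.1 v))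

/-! ### Powers of cycles -/

/-- The number of steps from `i` forward to `j` on the cycle. -/
def cycleOffset {n : ℕ} (i j : Fin n) : ℕ :=
  if i.val ≤ j.val then j.val - i.val else n + j.val - i.val

theorem cycleOffset_eq_sub {n : ℕ} (i j : Fin n) : cycleOffset i j = (j - i).val := by
  unfold cycleOffset
  split_ifs with h
  · rw [Fin.sub_val_of_le h]
  · rw [Fin.coe_sub_iff_lt.2 (by simpa using h)]

theorem cycleGraph_adj_iff_cycleOffset {n : ℕ} {i j : Fin n} :
    (SimpleGraph.cycleGraph n).Adj i j ↔ cycleOffset i j = 1 ∨ cycleOffset j i = 1 := by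
  rw [cycleOffset_eq_sub, cycleOffset_eq_sub, SimpleGraph.cycleGraph_adj', or_comm]

/-- Crossing an edge is one step forward or backward, so the smaller of the two offsets grows by at
most one. -/
theorem cycleOffset_le_length {n : ℕ} {i j : Fin n} (p : (SimpleGraph.cycleGraph n).Walk i j) :
    cycleOffset i j ≤ p.length ∨ cycleOffset j i ≤ p.length := by
  induction p with
  | nil => simp [cycleOffset]
  | @cons u v w h p ih =>
    rw [cycleGraph_adj_iff_cycleOffset] at h
    rw [SimpleGraph.Walk.length_cons]
    have := u.2
    have := v.2
    have := w.2
    unfold cycleOffset at *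
    split_ifs at * <;> omega

theorem edist_cycleGraph_le {n : ℕ} (i : Fin n) (k : ℕ) :
    ∀ j : Fin n, cycleOffset i j = k → (SimpleGraph.cycleGraph n).edist i j ≤ k := by
  induction k with
  | zero =>
    intro j h
    have : i = j := by
      ext
      have := i.2
      have := j.2
      unfold cycleOffset at h
      split_ifs at h <;> omega
    simp [this]
  | succ k ih =>
    intro j h
    have hi := i.2
    have hj := j.2
    obtain ⟨l, h1, h2⟩ : ∃ l : Fin n, cycleOffset i l = k ∧ cycleOffset l j = 1 := by
      -- The predecessor of `j` on the cycle is `n - 1` when `j = 0`.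
      by_cases h0 : j.val = 0
      · refine ⟨⟨n - 1, by omega⟩, ?_, ?_⟩ <;> unfold cycleOffset at * <;> split_ifs at * <;>
          simp only at * <;> omega
      · refine ⟨⟨j.val - 1, by omega⟩, ?_, ?_⟩ <;> unfold cycleOffset at * <;>
          split_ifs at * <;> simp only at * <;> omega
    refine (SimpleGraph.edist_triangle (v := l)).trans ?_
    rw [Nat.cast_succ]
    refine add_le_add (ih l h1) ?_
    exact (SimpleGraph.edist_eq_one_iff_adj.2 (cycleGraph_adj_iff_cycleOffset.2 (Or.inl h2))).le

theorem edist_cycleGraph_le_iff {n : ℕ} {i j : Fin n} {m : ℕ} :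
    (SimpleGraph.cycleGraph n).edist i j ≤ m ↔ cycleOffset i j ≤ m ∨ cycleOffset j i ≤ m := by
  constructor
  · intro h
    obtain ⟨p, hp⟩ := SimpleGraph.exists_walk_of_edist_ne_top
      (ne_top_of_le_ne_top (ENat.natCast_ne_top m) h)
    rw [← hp, Nat.cast_le] at h
    exact (cycleOffset_le_length p).imp (·.trans h) (·.trans h)
  · rintro (h | h)
    · exact (edist_cycleGraph_le i _ j rfl).trans (by exact_mod_cast h)
    · rw [SimpleGraph.edist_comm]
      exact (edist_cycleGraph_le j _ i rfl).trans (by exact_mod_cast h)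

theorem cyclePower_adj {n m : ℕ} {i j : Fin n} :
    (cyclePower n m).Adj i j ↔ i ≠ j ∧ (cycleOffset i j ≤ m ∨ cycleOffset j i ≤ m) :=
  and_congr_right fun _ => edist_cycleGraph_le_iff

theorem mem_closedNbhd_cyclePower {n m : ℕ} {i j : Fin n} :
    j ∈ closedNbhd (cyclePower n m) i ↔ cycleOffset i j ≤ m ∨ cycleOffset j i ≤ m := by
  rw [mem_closedNbhd, cyclePower_adj]
  constructor
  · rintro (rfl | h)
    · simp [cycleOffset]
    · exact h.2
  · intro h
    by_cases hij : j = i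
    · exact Or.inl hij
    · exact Or.inr ⟨Ne.symm hij, h⟩

theorem lt_cycleOffset_of_isIndepSet {n m : ℕ} {I : Finset (Fin n)}
    (hI : (cyclePower n m).IsIndepSet ↑I) {i j : Fin n} (hi : i ∈ I) (hj : j ∈ I) (hij : i ≠ j) :
    m < cycleOffset i j := by
  by_contra h
  exact hI hi hj hij (cyclePower_adj.2 ⟨hij, Or.inl (not_lt.1 h)⟩)

/-- The vertex `d` steps after `i` on the cycle. -/
def cycleShift {n : ℕ} (i : Fin n) (d : ℕ) : Fin n :=
  ⟨(i + d) % n, Nat.mod_lt _ i.pos⟩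

theorem cycleOffset_cycleShift {n : ℕ} (i : Fin n) {d : ℕ} (hd : d < n) :
    cycleOffset i (cycleShift i d) = d := by
  have hi := i.2
  unfold cycleOffset cycleShift
  simp only
  by_cases h : i.val + d < n
  · rw [Nat.mod_eq_of_lt h]
    split_ifs <;> omega
  · rw [Nat.mod_eq_sub_mod (not_lt.1 h), Nat.mod_eq_of_lt (by omega)]
    split_ifs <;> omega

theorem cycleOffset_lt {n : ℕ} (i j : Fin n) : cycleOffset i j < n := by
  have hi := i.2
  have hj := j.2
  unfold cycleOffset
  split_ifs <;> omega

theorem cycleOffset_injective {n : ℕ} (i : Fin n) : Function.Injective (cycleOffset i) := by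
  intro j k h
  have hi := i.2
  have hj := j.2
  have hk := k.2
  ext
  unfold cycleOffset at h
  split_ifs at h <;> omega

theorem cycleShift_cycleOffset {n : ℕ} (i j : Fin n) : cycleShift i (cycleOffset i j) = j :=
  cycleOffset_injective i (cycleOffset_cycleShift i (cycleOffset_lt i j))

theorem card_cycleOffset_lt {n : ℕ} (i : Fin n) {k : ℕ} (hk : k ≤ n) :
    (Finset.univ.filter fun j : Fin n => cycleOffset i j < k).card = k := by
  rw [← Finset.card_range k]
  refine Finset.card_bij (fun j _ => cycleOffset i j) (by simp)
    (fun _ _ _ _ h => cycleOffset_injective i h) ?_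
  intro d hd
  have := Finset.mem_range.1 hd
  have h := cycleOffset_cycleShift i (d := d) (by omega)
  exact ⟨cycleShift i d, by simpa [h] using hd, h⟩

/-! ### Neighborhoods in a join -/

theorem mem_closedNbhd_xJoin {V : Type*} {W : V → Type*} {G : SimpleGraph V}
    {R : ∀ v, SimpleGraph (W v)} {a b : Σ v, W v} :
    b ∈ closedNbhd (xJoin G R) a ↔
      G.Adj a.1 b.1 ∨ ∃ (v : V) (x y : W v), y ∈ closedNbhd (R v) x ∧ a = ⟨v, x⟩ ∧ b = ⟨v, y⟩ := by
  rw [mem_closedNbhd]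
  constructor
  · rintro (rfl | h | ⟨v, x, y, h, ha, hb⟩)
    · exact Or.inr ⟨b.1, b.2, b.2, self_mem_closedNbhd _ _, rfl, rfl⟩
    · exact Or.inl h
    · exact Or.inr ⟨v, x, y, mem_closedNbhd.2 (Or.inr h), ha, hb⟩
  · rintro (h | ⟨v, x, y, h, ha, hb⟩)
    · exact Or.inr (Or.inl h)
    · rcases mem_closedNbhd.1 h with rfl | h
      · exact Or.inl (hb.trans ha.symm)
      · exact Or.inr (Or.inr ⟨v, x, y, h, ha, hb⟩)

theorem mk_mem_closedNbhd_xJoin {V : Type*} {W : V → Type*} {G : SimpleGraph V}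
    {R : ∀ v, SimpleGraph (W v)} {v : V} {x y : W v} :
    (⟨v, y⟩ : Σ v, W v) ∈ closedNbhd (xJoin G R) ⟨v, x⟩ ↔ y ∈ closedNbhd (R v) x := by
  rw [mem_closedNbhd_xJoin]
  constructor
  · rintro (h | ⟨w, x', y', h, ha, hb⟩)
    · exact (h.ne rfl).elim
    · obtain ⟨rfl, hx⟩ := Sigma.mk.inj_iff.1 ha
      obtain ⟨-, hy⟩ := Sigma.mk.inj_iff.1 hb
      rwa [eq_of_heq hx, eq_of_heq hy]
  · exact fun h => Or.inr ⟨v, x, y, h, rfl, rfl⟩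

theorem mem_closedNbhd_xJoin_of_ne {V : Type*} {W : V → Type*} {G : SimpleGraph V}
    {R : ∀ v, SimpleGraph (W v)} {a b : Σ v, W v} (h : b.1 ≠ a.1) :
    b ∈ closedNbhd (xJoin G R) a ↔ b.1 ∈ closedNbhd G a.1 := by
  rw [mem_closedNbhd_xJoin, mem_closedNbhd]
  constructor
  · rintro (h | ⟨w, x', y', -, rfl, rfl⟩)
    · exact Or.inr h
    · exact Or.inl rfl
  · rintro (h' | h')
    · exact (h h').elim
    · exact Or.inl h'

theorem fst_mem_closedNbhd_of_mem {V : Type*} {W : V → Type*} {G : SimpleGraph V}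
    {R : ∀ v, SimpleGraph (W v)} {a b : Σ v, W v} (h : b ∈ closedNbhd (xJoin G R) a) :
    b.1 ∈ closedNbhd G a.1 := by
  by_cases hab : b.1 = a.1
  · exact hab ▸ self_mem_closedNbhd _ _
  · exact (mem_closedNbhd_xJoin_of_ne hab).1 h

/-! ### The upper bound -/

section Footprints

variable {V : Type*} {W : V → Type*} {G : SimpleGraph V} {R : ∀ v, SimpleGraph (W v)}
  {T : List (Σ v, W v)}

/-- The entry `t` of the sequence `T` footprints a vertex that replaces `j`. -/
def FootprintsIn (G : SimpleGraph V) (R : ∀ v, SimpleGraph (W v)) (T : List (Σ v, W v)) (j : V)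
    (t : Fin T.length) : Prop :=
  ∃ x : W j, (⟨j, x⟩ : Σ v, W v) ∈ privateNbhd (xJoin G R) T t

/-- No entry of `T` before `t` replaces a vertex in the closed neighborhood of `j`. -/
def IsFresh (G : SimpleGraph V) (T : List (Σ v, W v)) (t : Fin T.length) (j : V) : Prop :=
  ∀ s : Fin T.length, s < t → (T.get s).1 ∉ closedNbhd G j

/-- The first entry of `T` that replaces a vertex in the closed neighborhood of `b` replaces
`b` itself. -/
def IsRoot (G : SimpleGraph V) (T : List (Σ v, W v)) (b : V) : Prop :=
  ∃ t : Fin T.length, (T.get t).1 = b ∧ IsFresh G T t b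

/-- The plays that footprint in the graph at `j` are turned into a footprint list of `R j`. A play
inside the graph keeps its vertex; a play from outside is replaced by its footprint, which
footprints itself. -/
theorem card_footprintsIn_le (j : V) [Finite (W j)] [Nonempty (W j)]
    [DecidablePred (FootprintsIn G R T j)] :
    (Finset.univ.filter (FootprintsIn G R T j)).card ≤ grundyNumber (R j) := by
  have key : ∀ t : Fin T.length, ∃ p : W j × W j, FootprintsIn G R T j t →
      (⟨j, p.2⟩ : Σ v, W v) ∈ privateNbhd (xJoin G R) T t ∧
        (T.get t = ⟨j, p.1⟩ ∨ j ≠ (T.get t).1 ∧ p.1 = p.2) := by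
    intro t
    by_cases h : FootprintsIn G R T j t
    · obtain ⟨x, hx⟩ := h
      by_cases hj : j = (T.get t).1
      · subst hj
        exact ⟨((T.get t).2, x), fun _ => ⟨hx, Or.inl rfl⟩⟩
      · exact ⟨(x, x), fun _ => ⟨hx, Or.inr ⟨hj, rfl⟩⟩⟩
    · obtain ⟨x⟩ := ‹Nonempty (W j)›
      exact ⟨(x, x), fun h' => (h h').elim⟩
  choose p hp using key
  have hF : IsFootprintList (R j)
      (((List.finRange T.length).filter (FootprintsIn G R T j ·)).map p) := by
    constructor
    · intro q hq
      obtain ⟨t, ht, rfl⟩ := List.mem_map.1 hq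
      obtain ⟨h1, h2⟩ := hp t (by simpa using ht)
      rcases h2 with h2 | ⟨-, h2⟩
      · rw [mem_privateNbhd, h2, mk_mem_closedNbhd_xJoin] at h1
        exact h1.1
      · rw [h2]
        exact self_mem_closedNbhd _ _
    · rw [List.pairwise_map]
      refine List.Pairwise.imp_of_mem ?_
        ((List.pairwise_lt_finRange T.length).filter (FootprintsIn G R T j ·))
      intro s t hs ht hst
      obtain ⟨hs1, hs2⟩ := hp s (by simpa using hs)
      obtain ⟨ht1, -⟩ := hp t (by simpa using ht)
      have hn := (mem_privateNbhd.1 ht1).2 s hst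
      rcases hs2 with hs2 | ⟨hne, -⟩
      · rwa [hs2, mk_mem_closedNbhd_xJoin] at hn
      -- A play from outside that reaches the graph at `j` dominates all of it, so no later play can
      -- footprint there.
      · have := (mem_privateNbhd.1 hs1).1
        rw [mem_closedNbhd_xJoin_of_ne hne] at this hn
        exact (hn this).elim
  refine le_trans (le_of_eq ?_) hF.length_le_grundyNumber
  rw [List.length_map, ← List.toFinset_card_of_nodup ((List.nodup_finRange _).filter _)]
  congr 1
  ext t
  simp

/-- A play at a root footprints itself if it is the first one there; if it is a later one,
everything outside the graph of the root is already dominated. A play off the roots with a footprint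
over a nonroot `j` finds `j` fresh: earlier plays at neighbors of `j` would have dominated the
footprint, so the first earlier play in `N[j]` would be at `j` and make it a root. -/
theorem footprintsIn_or_fresh (hT : IsLegalDomSeq (xJoin G R) T) (t : Fin T.length) :
    (∃ b, IsRoot G T b ∧ FootprintsIn G R T b t) ∨
      (¬ IsRoot G T (T.get t).1 ∧ ∃ j ∈ closedNbhd G (T.get t).1, IsFresh G T t j) := by
  obtain ⟨⟨j, y⟩, hy⟩ := hT.2.2 t
  obtain ⟨hy1, hy2⟩ := mem_privateNbhd.1 hy
  by_cases hr : IsRoot G T (T.get t).1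
  · left
    obtain ⟨t₀, h0, hf⟩ := id hr
    rcases lt_trichotomy t t₀ with h | h | h
    · exact (hf t h (self_mem_closedNbhd _ _)).elim
    · subst h
      refine ⟨_, hr, (T.get t).2, mem_privateNbhd.2 ⟨self_mem_closedNbhd _ _, fun s hs hc => ?_⟩⟩
      exact hf s hs (mem_closedNbhd_comm.1 (fst_mem_closedNbhd_of_mem hc))
    · refine ⟨_, hr, ?_⟩
      by_cases hj : j = (T.get t).1
      · subst hj
        exact ⟨y, hy⟩
      · refine (hy2 t₀ h ?_).elim
        rw [mem_closedNbhd_xJoin_of_ne (by rw [h0]; exact hj), h0]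
        exact fst_mem_closedNbhd_of_mem hy1
  · by_cases hj : IsRoot G T j
    · exact Or.inl ⟨j, hj, y, hy⟩
    · refine Or.inr ⟨hr, j, fst_mem_closedNbhd_of_mem hy1, ?_⟩
      intro s
      -- The induction considers the first play in `N[j]`: the hypothesis excludes earlier ones, so
      -- a play at `j` itself would witness that `j` is a root.
      induction s using WellFoundedLT.induction with
      | _ s ih =>
        intro hs hc
        have hne : j ≠ (T.get s).1 := by
          rintro rfl
          exact hj ⟨s, rfl, fun s' hs' => ih s' hs' (hs'.trans hs)⟩
        refine hy2 s hs ?_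
        rw [mem_closedNbhd_xJoin_of_ne hne]
        exact mem_closedNbhd_comm.1 hc

/-- If the two are adjacent, the witness that comes first lies in the closed neighborhood of the
other root, before that root is played. -/
theorem IsRoot.not_adj {b c : V} (hb : IsRoot G T b) (hc : IsRoot G T c) : ¬ G.Adj b c := by
  intro h
  obtain ⟨s, rfl, hs⟩ := hb
  obtain ⟨t, rfl, ht⟩ := hc
  rcases lt_trichotomy s t with hst | rfl | hst
  · exact ht s hst (mem_closedNbhd.2 (Or.inr h.symm))
  · exact h.ne rfl
  · exact hs t hst (mem_closedNbhd.2 (Or.inr h))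

/-- A root is replaced by an entry of `T` before all its neighbors. -/
theorem IsRoot.exists_lt {b : V} (hb : IsRoot G T b) {t : Fin T.length}
    (ht : (T.get t).1 ∈ closedNbhd G b) (hne : ¬ IsRoot G T (T.get t).1) :
    ∃ s < t, (T.get s).1 = b := by
  obtain ⟨s, hs, hf⟩ := id hb
  refine ⟨s, ?_, hs⟩
  rcases lt_trichotomy s t with h | rfl | h
  · exact h
  · exact (hne (hs ▸ hb)).elim
  · exact (hf t h ht).elim

theorem IsFresh.ne_of_not_isRoot {t : Fin T.length} {j : V} (h : IsFresh G T t j)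
    (hr : ¬ IsRoot G T (T.get t).1) : j ≠ (T.get t).1 := by
  rintro rfl
  exact hr ⟨t, rfl, h⟩

end Footprints

/-! ### Charging fresh plays in a power of a cycle. -/

section Cycle

variable {n m : ℕ} {W : Fin n → Type*} {R : ∀ v, SimpleGraph (W v)}
  {T : List (Σ v, W v)}

open Classical in
/-- The entries of `T` that replace no root but dominate a fresh vertex. -/
noncomputable def freshTimes (n m : ℕ) {W : Fin n → Type*} (T : List (Σ v, W v)) :
    Finset (Fin T.length) :=
  Finset.univ.filter fun t => ¬ IsRoot (cyclePower n m) T (T.get t).1 ∧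
    ∃ j ∈ closedNbhd (cyclePower n m) (T.get t).1, IsFresh (cyclePower n m) T t j

/-- Such an entry charges a fresh vertex ahead of it, or itself when it dominates a fresh vertex
behind it. -/
theorem exists_charge {t : Fin T.length} (ht : t ∈ freshTimes n m T) :
    ∃ c : Fin n,
      (c ≠ (T.get t).1 ∧ cycleOffset (T.get t).1 c ≤ m ∧ IsFresh (cyclePower n m) T t c) ∨
      (c = (T.get t).1 ∧ ∃ j, j ≠ c ∧ cycleOffset j c ≤ m ∧ IsFresh (cyclePower n m) T t j) := by
  simp only [freshTimes, Finset.mem_filter, Finset.mem_univ, true_and] at ht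
  obtain ⟨hr, j, hj, hf⟩ := ht
  have hne := hf.ne_of_not_isRoot hr
  rcases mem_closedNbhd_cyclePower.1 hj with h | h
  · exact ⟨j, Or.inl ⟨hne, h, hf⟩⟩
  · exact ⟨_, Or.inr ⟨rfl, j, hne, h, hf⟩⟩

/-- The charges of `exists_charge` are injective and miss the arcs of `m + 1` vertices that start at
the roots, and these arcs are disjoint. Both facts rest on one principle: two vertices at most `m`
behind a common vertex are within `m` of each other. -/
theorem card_freshTimes_le (hn : 2 * (m + 1) ≤ n) (B : Finset (Fin n))
    (hB : ∀ b ∈ B, IsRoot (cyclePower n m) T b) :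
    (freshTimes n m T).card + B.card * (m + 1) ≤ n := by
  classical
  have hroot : ∀ t ∈ freshTimes n m T, ¬ IsRoot (cyclePower n m) T (T.get t).1 := by
    intro t ht
    simp only [freshTimes, Finset.mem_filter] at ht
    exact ht.2.1
  have : Nonempty (Fin n) := ⟨⟨0, by omega⟩⟩
  choose! f hf using fun t ht => exists_charge (n := n) (m := m) (T := T) (t := t) ht
  have hinj : Set.InjOn f (freshTimes n m T) := by
    have aux : ∀ s ∈ freshTimes n m T, ∀ t ∈ freshTimes n m T, s < t → f s ≠ f t := by
      intro s hs t ht hst heq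
      rcases hf t ht with ⟨-, -, h3⟩ | ⟨h1, j, h2, h3, h4⟩
      · have := h3 s hst
        rw [← heq] at this
        rw [mem_closedNbhd_cyclePower] at this
        rcases hf s hs with ⟨h1, h2, -⟩ | ⟨h1, -⟩
        · exact this (Or.inr h2)
        · exact this (Or.inl (by rw [h1]; simp [cycleOffset]))
      -- Here `t` charges its own position, with `j` fresh behind it. The earlier `s` charges the
      -- same position, so it lies there or at most `m` behind it, and hence already reaches `j`.
      · have := h4 s hst
        rw [mem_closedNbhd_cyclePower] at this
        rw [← heq] at h1 h2 h3
        rcases hf s hs with ⟨h1', h2', -⟩ | ⟨h1', -⟩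
        · generalize (T.get s).1 = a at *
          generalize f s = c at *
          have := a.2
          have := c.2
          have := j.2
          have hja : j.val ≠ c.val := fun h => h2 (Fin.ext h)
          unfold cycleOffset at *
          split_ifs at * <;> omega
        · rw [h1'] at h3
          exact this (Or.inl h3)
    intro s hs t ht heq
    rcases lt_trichotomy s t with h | h | h
    · exact (aux s hs t ht h heq).elim
    · exact h
    · exact (aux t ht s hs h heq.symm).elim
  have hcard : (B.biUnion fun b => Finset.univ.filter fun j => cycleOffset b j < m + 1).card =
      B.card * (m + 1) := by
    rw [Finset.card_biUnion, Finset.sum_const_nat]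
    · exact fun b _ => card_cycleOffset_lt b (by omega)
    · intro b hb c hc hbc
      have h1 := (hB b hb).not_adj (hB c hc)
      rw [cyclePower_adj] at h1
      rw [Function.onFun, Finset.disjoint_left]
      intro j hj hj'
      simp only [Finset.mem_filter, Finset.mem_univ, true_and] at hj hj'
      refine h1 ⟨hbc, ?_⟩
      have := b.2
      have := c.2
      have := j.2
      unfold cycleOffset at *
      split_ifs at * <;> omega
  -- If the charge of `t` lies in the arc of the root `b`, then `t` plays in `N[b]`, so `b` was
  -- played before `t`. The fresh vertex of `t` is within `m` of `b`, a contradiction.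
  have hdisj : Disjoint ((freshTimes n m T).image f)
      (B.biUnion fun b => Finset.univ.filter fun j => cycleOffset b j < m + 1) := by
    rw [Finset.disjoint_left]
    intro c hc hc'
    obtain ⟨t, ht, rfl⟩ := Finset.mem_image.1 hc
    obtain ⟨b, hb, hbc⟩ := Finset.mem_biUnion.1 hc'
    simp only [Finset.mem_filter, Finset.mem_univ, true_and] at hbc
    have hne : (T.get t).1 ≠ b := fun h => hroot t ht (h ▸ hB b hb)
    have hne' : (T.get t).1.val ≠ b.val := fun h => hne (Fin.ext h)
    have hat := (T.get t).1.2
    have hbt := b.2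
    have hft := (f t).2
    rcases hf t ht with ⟨h1, h2, h3⟩ | ⟨h1, j, h2, h3, h4⟩
    · obtain ⟨s, hst, hs⟩ := (hB b hb).exists_lt (t := t) (by
        rw [mem_closedNbhd_cyclePower]
        generalize (T.get t).1 = a at *
        unfold cycleOffset at *
        split_ifs at * <;> omega) (hroot t ht)
      refine h3 s hst ?_
      rw [hs, mem_closedNbhd_cyclePower]
      omega
    · obtain ⟨s, hst, hs⟩ := (hB b hb).exists_lt (t := t) (by
        rw [mem_closedNbhd_cyclePower]
        rw [h1] at hbc
        omega) (hroot t ht)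
      refine h4 s hst ?_
      rw [hs, mem_closedNbhd_cyclePower]
      rw [h1] at hbc h3 h2
      generalize (T.get t).1 = a at *
      have := j.2
      unfold cycleOffset at *
      split_ifs at * <;> omega
  have := Finset.card_le_univ (((freshTimes n m T).image f) ∪
    (B.biUnion fun b => Finset.univ.filter fun j => cycleOffset b j < m + 1))
  rwa [Finset.card_union_of_disjoint hdisj, Finset.card_image_of_injOn hinj, hcard,
    Fintype.card_fin] at this

/-- The first play is at a root, so all counted plays come later. Their fresh vertices are distinct
and avoid the closed neighborhood of the first play. -/
theorem card_freshTimes_le_of_first (hn : 2 * (m + 1) ≤ n) (h0 : 0 < T.length) :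
    (freshTimes n m T).card + (2 * m + 1) ≤ n := by
  classical
  set b := (T.get ⟨0, h0⟩).1 with hb
  have hpos : ∀ t ∈ freshTimes n m T, (⟨0, h0⟩ : Fin T.length) < t := by
    intro t ht
    simp only [freshTimes, Finset.mem_filter, Finset.mem_univ, true_and] at ht
    rw [Fin.lt_def]
    refine Nat.pos_of_ne_zero fun h => ht.1 ⟨t, rfl, fun s hs => ?_⟩
    exact (Nat.not_lt_zero s.val (by have := Fin.lt_def.1 hs; omega)).elim
  have hex : ∀ t ∈ freshTimes n m T, ∃ j : Fin n,
      j ∈ closedNbhd (cyclePower n m) (T.get t).1 ∧ IsFresh (cyclePower n m) T t j := by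
    intro t ht
    simp only [freshTimes, Finset.mem_filter, Finset.mem_univ, true_and] at ht
    exact ht.2
  have : Nonempty (Fin n) := ⟨b⟩
  choose! f hf using hex
  have hinj : Set.InjOn f (freshTimes n m T) := by
    intro s hs t ht heq
    rcases lt_trichotomy s t with h | h | h
    · exact ((hf t ht).2 s h (mem_closedNbhd_comm.1 (heq ▸ (hf s hs).1))).elim
    · exact h
    · exact ((hf s hs).2 t h (mem_closedNbhd_comm.1 (heq ▸ (hf t ht).1))).elim
  -- The closed neighborhood of `b` is the arc of length `2 * m + 1` that starts `m` steps before
  -- `b`, which is `n - m` steps after it.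
  have hsub : (freshTimes n m T).image f ⊆
      ((Finset.univ.filter fun j => cycleOffset (cycleShift b (n - m)) j < 2 * m + 1))ᶜ := by
    intro c hc
    obtain ⟨t, ht, rfl⟩ := Finset.mem_image.1 hc
    have h1 := (hf t ht).2 _ (hpos t ht)
    rw [← hb, mem_closedNbhd_cyclePower] at h1
    simp only [Finset.mem_compl, Finset.mem_filter, Finset.mem_univ, true_and]
    intro h2
    have hbt := b.2
    have hft := (f t).2
    -- For `m = 0` the shift by `n - m = n` is not an offset below `n`.
    by_cases hm : m = 0
    · subst hm
      have : cycleShift b (n - 0) = b := by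
        ext
        simp [cycleShift, Nat.mod_eq_of_lt hbt]
      rw [this] at h2
      omega
    have h3 := cycleOffset_cycleShift b (d := n - m) (by omega)
    have := (cycleShift b (n - m)).2
    generalize cycleShift b (n - m) = a at *
    unfold cycleOffset at *
    split_ifs at * <;> omega
  have := Finset.card_le_card hsub
  rw [Finset.card_image_of_injOn hinj, Finset.card_compl, card_cycleOffset_lt _ (by omega),
    Fintype.card_fin] at this
  omega

/-- A legal dominating sequence of the join is bounded by the weight of an independent set with at
least two vertices. -/
theorem exists_isIndepSet_length_le [∀ i, Finite (W i)] [∀ i, Nonempty (W i)]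
    (hn : 2 * (m + 1) ≤ n) (hT : IsLegalDomSeq (xJoin (cyclePower n m) R) T) :
    ∃ I : Finset (Fin n), (cyclePower n m).IsIndepSet ↑I ∧ 2 ≤ I.card ∧
      T.length + I.card * (m + 1) ≤ ∑ i ∈ I, grundyNumber (R i) + n := by
  classical
  have h0 : 0 < T.length := by
    obtain ⟨x⟩ := ‹∀ i, Nonempty (W i)› ⟨0, by omega⟩
    obtain ⟨u, hu, -⟩ := hT.2.1 ⟨_, x⟩
    exact List.length_pos_of_mem hu
  set B : Finset (Fin n) := Finset.univ.filter (IsRoot (cyclePower n m) T) with hBdef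
  have hB : ∀ b, b ∈ B ↔ IsRoot (cyclePower n m) T b := by simp [hBdef]
  have hcount : T.length ≤ ∑ b ∈ B, grundyNumber (R b) + (freshTimes n m T).card := by
    have hcover : (Finset.univ : Finset (Fin T.length)) ⊆
        (B.biUnion fun b => Finset.univ.filter (FootprintsIn (cyclePower n m) R T b)) ∪
          freshTimes n m T := by
      intro t _
      rcases footprintsIn_or_fresh hT t with ⟨b, hb, ht⟩ | h
      · exact Finset.mem_union_left _
          (Finset.mem_biUnion.2 ⟨b, (hB b).2 hb, by simpa using ht⟩)
      · exact Finset.mem_union_right _ (by simpa [freshTimes] using h)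
    have := (Finset.card_le_card hcover).trans (Finset.card_union_le _ _)
    rw [Finset.card_univ, Fintype.card_fin] at this
    refine this.trans (Nat.add_le_add_right ?_ _)
    exact Finset.card_biUnion_le.trans (Finset.sum_le_sum fun b _ => card_footprintsIn_le b)
  have hfirst : (T.get ⟨0, h0⟩).1 ∈ B := by
    refine (hB _).2 ⟨⟨0, h0⟩, rfl, fun s hs => ?_⟩
    exact (Nat.not_lt_zero _ (Fin.lt_def.1 hs)).elim
  by_cases h2 : 2 ≤ B.card
  · refine ⟨B, ?_, h2, ?_⟩
    · intro b hb c hc _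
      exact ((hB b).1 hb).not_adj ((hB c).1 hc)
    · have := card_freshTimes_le (T := T) hn B fun b hb => (hB b).1 hb
      omega
  · obtain ⟨b, hb⟩ : ∃ b, B = {b} := by
      refine Finset.card_eq_one.1 ?_
      have := Finset.card_pos.2 ⟨_, hfirst⟩
      omega
    have hf := card_freshTimes_le_of_first (n := n) (m := m) hn h0
    -- With a single root `b`, the nearest vertex not adjacent to it is added. It costs `m + 1` and
    -- brings at least 1, exactly what the gain from `m + 1` to `2 * m + 1` pays for.
    have hoff := cycleOffset_cycleShift b (d := m + 1) (by omega)
    have hbt := b.2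
    set c := cycleShift b (m + 1)
    have hct := c.2
    have hbc : b ≠ c := by
      intro h
      rw [← h] at hoff
      simp [cycleOffset] at hoff
    have hnadj : ¬ (cyclePower n m).Adj b c := by
      rw [cyclePower_adj]
      rintro ⟨-, h⟩
      unfold cycleOffset at *
      split_ifs at * <;> omega
    refine ⟨{b, c}, ?_, (Finset.card_pair hbc).ge, ?_⟩
    · rw [Finset.coe_pair, SimpleGraph.IsIndepSet, Set.pairwise_pair]
      exact fun _ => ⟨hnadj, fun h => hnadj h.symm⟩
    · have := one_le_grundyNumber (R c)
      rw [hb, Finset.sum_singleton] at hcount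
      rw [Finset.card_pair hbc, Finset.sum_pair hbc]
      omega

end Cycle

/-! ### Construction of legal dominating sequences of the join -/

section Block

variable {V : Type*} {W : V → Type*} {G : SimpleGraph V} {R : ∀ v, SimpleGraph (W v)}

/-- A sequence of vertices of `R i`, as a sequence of vertices of the join. -/
def joinBlock (S : ∀ v, List (W v)) (i : V) : List (Σ v, W v) :=
  (S i).map (Sigma.mk i)

/-- Within the copy of `R i`, neighborhoods in the join are those of `R i`, so a continuation stays
legal when `D` meets that copy exactly in `E`. -/
theorem legalFrom_map_append {i : V} {S : List (W i)} {L : List (Σ v, W v)} :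
    ∀ {D : Set (Σ v, W v)} {E : Set (W i)}, LegalFrom (R i) E S → (∀ x, ⟨i, x⟩ ∈ D ↔ x ∈ E) →
      LegalFrom (xJoin G R) (D ∪ {x | ∃ u ∈ S, x ∈ closedNbhd (xJoin G R) ⟨i, u⟩}) L →
      LegalFrom (xJoin G R) D (S.map (Sigma.mk i) ++ L) := by
  induction S with
  | nil =>
    intro D E _ _ hL
    simpa using hL
  | cons u S ih =>
    rintro D E ⟨⟨x, hx, hxE⟩, hS⟩ hD hL
    refine ⟨⟨⟨i, x⟩, mk_mem_closedNbhd_xJoin.2 hx, fun h => hxE ((hD x).1 h)⟩, ih hS ?_ ?_⟩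
    · intro y
      rw [Set.mem_union, Set.mem_union, hD, mk_mem_closedNbhd_xJoin]
    · convert hL using 1
      ext y
      simp [or_assoc]

/-- The sequence dominates the whole graph at `i` and, not being empty, every graph at a neighbor of
`i`. -/
theorem legalFrom_joinBlock_append {i : V} [Nonempty (W i)] {S : ∀ v, List (W v)}
    {L : List (Σ v, W v)} {D : Set (Σ v, W v)} (hS : IsLegalDomSeq (R i) (S i))
    (hD : ∀ x, ⟨i, x⟩ ∉ D)
    (hL : LegalFrom (xJoin G R) (D ∪ {x | x.1 ∈ closedNbhd G i}) L) :
    LegalFrom (xJoin G R) D (joinBlock S i ++ L) := by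
  refine legalFrom_map_append hS.legalFrom (by simpa using hD) ?_
  convert hL using 2
  ext ⟨j, y⟩
  simp only [Set.mem_ofPred_eq]
  constructor
  · rintro ⟨u, -, h⟩
    exact fst_mem_closedNbhd_of_mem h
  · intro h
    by_cases hj : j = i
    · subst hj
      obtain ⟨u, hu, hy⟩ := hS.2.1 y
      exact ⟨u, hu, mk_mem_closedNbhd_xJoin.2 (mem_closedNbhd_comm.1 hy)⟩
    · obtain ⟨x⟩ := ‹Nonempty (W i)›
      obtain ⟨u, hu, -⟩ := hS.2.1 x
      exact ⟨u, hu, (mem_closedNbhd_xJoin_of_ne hj).2 h⟩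

end Block

/-! ### Plays around the cycle, in offsets from a start. -/

theorem mem_closedNbhd_cyclePower_iff_of_base {n m : ℕ} (s i j : Fin n) :
    j ∈ closedNbhd (cyclePower n m) i ↔
      (cycleOffset s j ≤ cycleOffset s i + m ∧ cycleOffset s i ≤ cycleOffset s j + m) ∨
        n + cycleOffset s j ≤ cycleOffset s i + m ∨
        n + cycleOffset s i ≤ cycleOffset s j + m := by
  have := s.2
  have := i.2
  have := j.2
  rw [mem_closedNbhd_cyclePower]
  unfold cycleOffset
  split_ifs <;> omega

/-- The largest number of vertices that can be played in the offsets from `c` on, when those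
before `c` and the last `m` are dominated. Here `g d` is the length of the sequence of the graph
at offset `d`. -/
def playValue (n m : ℕ) (g : ℕ → ℕ) (c : ℕ) : ℕ :=
  if c + m + 1 ≤ n then
    max (max (g c + (n - (c + m + 1))) (1 + playValue n m g (c + 1)))
      (g c + playValue n m g (c + m + 1))
  else 0
  termination_by n - c

theorem playValue_of_lt {n m : ℕ} {g : ℕ → ℕ} {c : ℕ} (h : n < c + m + 1) :
    playValue n m g c = 0 := by
  rw [playValue, if_neg (not_le.2 h)]

theorem playValue_of_le {n m : ℕ} {g : ℕ → ℕ} {c : ℕ} (h : c + m + 1 ≤ n) :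
    playValue n m g c = max (max (g c + (n - (c + m + 1))) (1 + playValue n m g (c + 1)))
      (g c + playValue n m g (c + m + 1)) := by
  rw [playValue, if_pos h]

/-- Read `J` from the left. An offset outside `J` is consumed by a single play, a member of `J`
other than the last by a jump, and the last one by the finishing move. Each member thus costs `m +
1` of the `n - c` available plays and brings `g`. -/
theorem sum_le_playValue {n m : ℕ} {g : ℕ → ℕ} (k : ℕ) : ∀ (c : ℕ) (J : Finset ℕ),
    n - c = k → J.Nonempty → (∀ j ∈ J, c ≤ j ∧ j + m + 1 ≤ n) →
    (∀ i ∈ J, ∀ j ∈ J, i < j → i + m + 1 ≤ j) →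
    ∑ j ∈ J, g j + n ≤ playValue n m g c + c + J.card * (m + 1) := by
  induction k using Nat.strong_induction_on with
  | _ k ih =>
    intro c J hk hne hr hgap
    obtain ⟨j₀, hj₀⟩ := id hne
    have hc : c + m + 1 ≤ n := by have := hr j₀ hj₀; omega
    have hv := playValue_of_le (g := g) hc
    by_cases hcJ : c ∈ J
    · have hs := Finset.add_sum_erase J g hcJ
      have hcard := Finset.card_erase_add_one hcJ
      rcases (J.erase c).eq_empty_or_nonempty with he | he
      · rw [he] at hs hcard
        simp only [Finset.sum_empty, Finset.card_empty] at hs hcard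
        rw [← hcard]
        omega
      · have := ih (n - (c + m + 1)) (by omega) (c + m + 1) (J.erase c) rfl he
          (by
            intro j hj
            have hj' := Finset.mem_erase.1 hj
            have h1 := hr j hj'.2
            have h2 := hgap c hcJ j hj'.2 (by omega)
            omega)
          (fun i hi j hj => hgap i (Finset.mem_of_mem_erase hi) j (Finset.mem_of_mem_erase hj))
        rw [← hcard, add_mul]
        omega
    · have := ih (n - (c + 1)) (by omega) (c + 1) J rfl hne
        (by
          intro j hj
          have h1 := hr j hj
          have h2 : j ≠ c := fun h => hcJ (h ▸ hj)
          omega) hgap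
      omega

section Play

variable {n : ℕ} {W : Fin n → Type*} (m : ℕ) (S : ∀ i, List (W i)) (rep : ∀ i, W i) (s : Fin n)

/-- The length of the sequence at offset `d` from `s`. -/
def offsetLength (d : ℕ) : ℕ := (S (cycleShift s d)).length

/-- One vertex at offset `d` from `s`. -/
def repAt (d : ℕ) : Σ i, W i := ⟨cycleShift s d, rep _⟩

/-- Vertices at the offsets `d + k - 1, …, d`. -/
def backPlays (d : ℕ) : ℕ → List (Σ i, W i)
  | 0 => []
  | k + 1 => repAt rep s (d + k) :: backPlays d k

/-- A play of length `playValue`. -/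
def playFrom (c : ℕ) : List (Σ i, W i) :=
  let g := offsetLength S s
  if c + m + 1 ≤ n then
    if 1 + playValue n m g (c + 1) ≤ g c + (n - (c + m + 1)) ∧
        g c + playValue n m g (c + m + 1) ≤ g c + (n - (c + m + 1)) then
      backPlays rep s (c + m + 1) (n - (c + m + 1)) ++ joinBlock S (cycleShift s c)
    else if g c + playValue n m g (c + m + 1) ≤ 1 + playValue n m g (c + 1) then
      repAt rep s (c - m) :: playFrom (c + 1)
    else joinBlock S (cycleShift s c) ++ playFrom (c + m + 1)
  else []
  termination_by n - c

/-- A legal dominating sequence that starts with the sequence of the graph at `s`. -/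
def fullPlay : List (Σ i, W i) :=
  joinBlock S s ++ playFrom m S rep s (m + 1)

theorem length_backPlays (d k : ℕ) : (backPlays rep s d k).length = k := by
  induction k with
  | zero => rfl
  | succ k ih => rw [backPlays, List.length_cons, ih]

theorem length_playFrom (k : ℕ) : ∀ c, n - c = k →
    (playFrom m S rep s c).length = playValue n m (offsetLength S s) c := by
  induction k using Nat.strong_induction_on with
  | _ k ih =>
    intro c hk
    rw [playFrom]
    by_cases hc : c + m + 1 ≤ n
    · have h1 := ih (n - (c + 1)) (by omega) (c + 1) rfl
      have h2 := ih (n - (c + m + 1)) (by omega) (c + m + 1) rfl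
      have hb : (joinBlock S (cycleShift s c)).length = offsetLength S s c := by
        simp [joinBlock, offsetLength]
      rw [if_pos hc, playValue_of_le hc]
      split_ifs <;> simp only [List.length_append, List.length_cons, length_backPlays, hb, h1, h2]
        <;> omega
    · rw [if_neg hc, playValue_of_lt (by omega)]
      rfl

theorem length_fullPlay : (fullPlay m S rep s).length =
    (S s).length + playValue n m (offsetLength S s) (m + 1) := by
  rw [fullPlay, List.length_append, length_playFrom m S rep s _ _ rfl, joinBlock, List.length_map]

variable {m S s} {R : ∀ i, SimpleGraph (W i)}

/-- The play at offset `c + m + 1 + k` footprints offset `c + 1 + k`, at distance `m`. As `1 ≤ m`,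
this is another graph, so any vertex works and dominates all of it. No such play reaches `c`, not
even around the cycle, since `m + 1 ≤ c`. -/
theorem legalFrom_backPlays_append (hm : 1 ≤ m) {c : ℕ} (hc : m + 1 ≤ c) {L : List (Σ i, W i)}
    (hL : LegalFrom (xJoin (cyclePower n m) R)
      {x | cycleOffset s x.1 < c ∨ c + 1 ≤ cycleOffset s x.1} L) (k : ℕ) :
    c + 1 + k + m ≤ n → LegalFrom (xJoin (cyclePower n m) R)
      {x | cycleOffset s x.1 < c ∨ c + 1 + k ≤ cycleOffset s x.1}
      (backPlays rep s (c + m + 1) k ++ L) := by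
  induction k with
  | zero => exact fun _ => hL
  | succ k ih =>
    intro hk
    have ho := cycleOffset_cycleShift s (d := c + m + 1 + k) (by omega)
    have ho' := cycleOffset_cycleShift s (d := c + 1 + k) (by omega)
    refine ⟨⟨⟨cycleShift s (c + 1 + k), rep _⟩, ?_, ?_⟩, ?_⟩
    · rw [mem_closedNbhd_xJoin_of_ne, mem_closedNbhd_cyclePower_iff_of_base s]
      · simp only [repAt, ho, ho']
        omega
      · intro h
        have := congrArg (cycleOffset s) h
        simp only [repAt, ho, ho'] at this
        omega
    · simp only [Set.mem_ofPred_eq, ho']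
      omega
    · convert ih (by omega) using 1
      swap
      · rfl
      ext x
      simp only [Set.mem_union, Set.mem_ofPred_eq]
      have hx := cycleOffset_lt s x.1
      by_cases hxa : x.1 = (repAt rep s (c + m + 1 + k)).1
      · have : cycleOffset s x.1 = c + m + 1 + k := by rw [hxa]; exact ho
        omega
      · rw [mem_closedNbhd_xJoin_of_ne hxa, mem_closedNbhd_cyclePower_iff_of_base s]
        simp only [repAt, ho]
        omega

/-- The undominated offsets always form the interval from `c` to `n - m - 1`. A single play at `c -
m` dominates `c` and nothing beyond it; a sequence at `c` dominates up to `c + m`; the finishing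
back plays leave only `c`. -/
theorem legalFrom_playFrom (hm : 1 ≤ m) [∀ i, Nonempty (W i)]
    (hS : ∀ i, IsLegalDomSeq (R i) (S i)) (k : ℕ) : ∀ c, n - c = k → m + 1 ≤ c → c + m + 1 ≤ n →
    LegalFrom (xJoin (cyclePower n m) R)
      {x | cycleOffset s x.1 < c ∨ n - m ≤ cycleOffset s x.1} (playFrom m S rep s c) := by
  induction k using Nat.strong_induction_on with
  | _ k ih =>
    intro c hk hc hcn
    have hg : 1 ≤ offsetLength S s c := by
      obtain ⟨x⟩ := ‹∀ i, Nonempty (W i)› (cycleShift s c)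
      obtain ⟨u, hu, -⟩ := (hS _).2.1 x
      exact List.length_pos_of_mem hu
    have ho := cycleOffset_cycleShift s (d := c) (by omega)
    rw [playFrom]
    simp only [if_pos hcn]
    split_ifs with h1 h2
    · have := legalFrom_backPlays_append rep (m := m) (s := s) (R := R) hm hc
        (L := joinBlock S (cycleShift s c) ++ []) (k := n - (c + m + 1)) ?_ (by omega)
      · rw [List.append_nil] at this
        convert this using 1
        ext x
        simp only [Set.mem_ofPred_eq]
        omega
      · refine legalFrom_joinBlock_append (hS _) ?_ ?_
        · intro x
          simp only [Set.mem_ofPred_eq, ho]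
          omega
        · refine Set.eq_univ_of_forall fun x => ?_
          simp only [Set.mem_union, Set.mem_ofPred_eq]
          rw [mem_closedNbhd_cyclePower_iff_of_base s, ho]
          omega
    · have hc1 : c + 1 + m + 1 ≤ n := by
        by_contra hlt
        rw [playValue_of_lt (by omega), playValue_of_lt (by omega)] at h1
        omega
      have ho' := cycleOffset_cycleShift s (d := c - m) (by omega)
      refine ⟨⟨⟨cycleShift s c, rep _⟩, ?_, ?_⟩, ?_⟩
      · rw [mem_closedNbhd_xJoin_of_ne, mem_closedNbhd_cyclePower_iff_of_base s]
        · simp only [repAt, ho, ho']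
          omega
        · intro h
          have := congrArg (cycleOffset s) h
          simp only [repAt, ho, ho'] at this
          omega
      · simp only [Set.mem_ofPred_eq, ho]
        omega
      · convert ih _ (by omega) (c + 1) rfl (by omega) hc1 using 1
        ext x
        simp only [Set.mem_union, Set.mem_ofPred_eq]
        have hx := cycleOffset_lt s x.1
        by_cases hxa : x.1 = (repAt rep s (c - m)).1
        · have : cycleOffset s x.1 = c - m := by rw [hxa]; exact ho'
          omega
        · rw [mem_closedNbhd_xJoin_of_ne hxa, mem_closedNbhd_cyclePower_iff_of_base s]
          simp only [repAt, ho']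
          omega
    -- A jump that leaves nothing to dominate is worth only `g c` and cannot beat the finishing
    -- move.
    · have hc1 : c + m + 1 + m + 1 ≤ n := by
        by_contra hlt
        rw [playValue_of_lt (c := c + m + 1) (by omega)] at h1 h2
        omega
      refine legalFrom_joinBlock_append (hS _) ?_ ?_
      · intro x
        simp only [Set.mem_ofPred_eq, ho]
        omega
      · convert ih _ (by omega) (c + m + 1) rfl (by omega) hc1 using 1
        ext x
        simp only [Set.mem_union, Set.mem_ofPred_eq]
        have hx := cycleOffset_lt s x.1
        rw [mem_closedNbhd_cyclePower_iff_of_base s, ho]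
        omega

theorem isLegalDomSeq_fullPlay (hm : 1 ≤ m) (hn : 2 * (m + 1) ≤ n) [∀ i, Nonempty (W i)]
    (hS : ∀ i, IsLegalDomSeq (R i) (S i)) :
    IsLegalDomSeq (xJoin (cyclePower n m) R) (fullPlay m S rep s) := by
  refine LegalFrom.isLegalDomSeq (legalFrom_joinBlock_append (hS s) (by simp) ?_)
  convert legalFrom_playFrom rep hm hS _ (m + 1) rfl le_rfl (by omega) using 1
  ext x
  have hx := cycleOffset_lt s x.1
  have hs : cycleOffset s s = 0 := by simp [cycleOffset]
  simp only [Set.empty_union, Set.mem_ofPred_eq]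
  rw [mem_closedNbhd_cyclePower_iff_of_base s, hs]
  omega

/-- Seen from `s`, the other members of `I` have offsets at least `m + 1` apart and between `m + 1`
and `n - m - 1`, as `sum_le_playValue` requires. -/
theorem sum_le_length_fullPlay {I : Finset (Fin n)} (hI : (cyclePower n m).IsIndepSet ↑I)
    (h2 : 2 ≤ I.card) (hs : s ∈ I) :
    ∑ i ∈ I, (S i).length + n ≤ (fullPlay m S rep s).length + I.card * (m + 1) := by
  have hinj : Set.InjOn (cycleOffset s) ↑(I.erase s) := (cycleOffset_injective s).injOn
  have hcard := Finset.card_erase_add_one hs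
  have hmem : ∀ j ∈ (I.erase s).image (cycleOffset s),
      ∃ i ∈ I, i ≠ s ∧ cycleOffset s i = j := by
    intro j hj
    obtain ⟨i, hi, rfl⟩ := Finset.mem_image.1 hj
    exact ⟨i, Finset.mem_of_mem_erase hi, Finset.ne_of_mem_erase hi, rfl⟩
  have := sum_le_playValue (n := n) (m := m) (g := offsetLength S s) _ (m + 1)
    ((I.erase s).image (cycleOffset s)) rfl
    ((Finset.card_pos.1 (by omega)).image _)
    (by
      intro j hj
      obtain ⟨i, hi, his, rfl⟩ := hmem j hj
      have h1 := lt_cycleOffset_of_isIndepSet hI hs hi (Ne.symm his)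
      have h2 := lt_cycleOffset_of_isIndepSet hI hi hs his
      have := s.2
      have := i.2
      unfold cycleOffset at *
      split_ifs at * <;> omega)
    (by
      intro j hj k hk hjk
      obtain ⟨i, hi, his, rfl⟩ := hmem j hj
      obtain ⟨l, hl, hls, rfl⟩ := hmem k hk
      have h1 := lt_cycleOffset_of_isIndepSet hI hi hl (by rintro rfl; omega)
      have := s.2
      have := i.2
      have := l.2
      unfold cycleOffset at *
      split_ifs at * <;> omega)
  rw [Finset.sum_image hinj, Finset.card_image_of_injOn hinj] at this
  have hsum : ∑ i ∈ I.erase s, offsetLength S s (cycleOffset s i) =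
      ∑ i ∈ I.erase s, (S i).length :=
    Finset.sum_congr rfl fun i _ => by rw [offsetLength, cycleShift_cycleOffset]
  rw [hsum] at this
  rw [length_fullPlay, ← hcard, ← Finset.add_sum_erase I _ hs, add_mul]
  omega

end Play

/-! ### The Grundy domination number of the join -/

section Value

variable {n m : ℕ} {W : Fin n → Type*} [∀ i, Finite (W i)] [∀ i, Nonempty (W i)]
  {R : ∀ i, SimpleGraph (W i)}

/-- A legal dominating sequence that is at least as long as the value of every independent set with
two or more vertices is a Grundy dominating sequence. -/
theorem isGds_xJoin_of_forall_le (hn : 2 * (m + 1) ≤ n) {T : List (Σ i, W i)}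
    (hT : IsLegalDomSeq (xJoin (cyclePower n m) R) T)
    (h : ∀ I : Finset (Fin n), (cyclePower n m).IsIndepSet ↑I → 2 ≤ I.card →
      ∑ i ∈ I, grundyNumber (R i) + n ≤ T.length + I.card * (m + 1)) :
    IsGds (xJoin (cyclePower n m) R) T := by
  refine ⟨hT, fun T' hT' => ?_⟩
  obtain ⟨I, hI, h2, hle⟩ := exists_isIndepSet_length_le hn hT'
  have := h I hI h2
  omega

theorem le_grundyNumber_xJoin (hm : 1 ≤ m) (hn : 2 * (m + 1) ≤ n) {I : Finset (Fin n)}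
    (hI : (cyclePower n m).IsIndepSet ↑I) (h2 : 2 ≤ I.card) :
    ∑ i ∈ I, grundyNumber (R i) + n ≤
      grundyNumber (xJoin (cyclePower n m) R) + I.card * (m + 1) := by
  choose S hS using fun i => exists_isGds (R i)
  obtain ⟨s, hs⟩ := Finset.card_pos.1 (by omega : 0 < I.card)
  have rep : ∀ i, W i := fun i => Classical.arbitrary _
  have h := sum_le_length_fullPlay (S := S) rep hI h2 hs
  have := (isLegalDomSeq_fullPlay (S := S) (s := s) rep hm hn
    fun i => (hS i).1).length_le_grundyNumber
  rw [Finset.sum_congr rfl fun i _ => (hS i).length_eq] at h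
  omega

theorem exists_isIndepSet_grundyNumber_xJoin_le (hn : 2 * (m + 1) ≤ n) :
    ∃ I : Finset (Fin n), (cyclePower n m).IsIndepSet ↑I ∧ 2 ≤ I.card ∧
      grundyNumber (xJoin (cyclePower n m) R) + I.card * (m + 1) ≤
        ∑ i ∈ I, grundyNumber (R i) + n := by
  obtain ⟨T, hT⟩ := exists_isGds (xJoin (cyclePower n m) R)
  obtain ⟨I, hI, h2, hle⟩ := exists_isIndepSet_length_le hn hT.1
  exact ⟨I, hI, h2, hT.length_eq ▸ hle⟩

end Value

/-! ### Weights of independent sets and the reduction to two vertices. -/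

section Weight

variable {V : Type*} {G : SimpleGraph V} {w : V → ℤ}

theorem finite_setOf_sum [Finite V] (P : Finset V → Prop) (w : V → ℤ) :
    {x : ℤ | ∃ I : Finset V, P I ∧ x = ∑ i ∈ I, w i}.Finite := by
  classical
  have := Fintype.ofFinite V
  refine (Set.finite_range fun I : Finset V => ∑ i ∈ I, w i).subset ?_
  rintro _ ⟨I, -, rfl⟩
  exact ⟨I, rfl⟩

theorem sum_le_alphaWeight [Finite V] {I : Finset V} (hI : G.IsIndepSet ↑I) :
    ∑ i ∈ I, w i ≤ alphaWeight G w :=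
  le_csSup (finite_setOf_sum _ w).bddAbove ⟨I, hI, rfl⟩

theorem sum_le_alphaWeightTwo [Finite V] {I : Finset V} (hI : G.IsIndepSet ↑I) (h2 : I.card = 2) :
    ∑ i ∈ I, w i ≤ alphaWeightTwo G w := by
  refine le_csSup ?_ ⟨I, hI, h2, rfl⟩
  simpa only [and_assoc] using
    (finite_setOf_sum (fun I => G.IsIndepSet ↑I ∧ I.card = 2) w).bddAbove

theorem exists_sum_eq_alphaWeightTwo [Finite V] {J : Finset V} (hJ : G.IsIndepSet ↑J) (h2 : J.card = 2) :
    ∃ I : Finset V, G.IsIndepSet ↑I ∧ I.card = 2 ∧ ∑ i ∈ I, w i = alphaWeightTwo G w := by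
  have hfin : {x : ℤ | ∃ I : Finset V, G.IsIndepSet ↑I ∧ I.card = 2 ∧ x = ∑ i ∈ I, w i}.Finite := by
    simpa only [and_assoc] using
      finite_setOf_sum (fun I => G.IsIndepSet ↑I ∧ I.card = 2) w
  obtain ⟨I, hI, hc, h⟩ := Set.Nonempty.csSup_mem (s := {x : ℤ | ∃ I : Finset V,
    G.IsIndepSet ↑I ∧ I.card = 2 ∧ x = ∑ i ∈ I, w i}) ⟨_, J, hJ, h2, rfl⟩ hfin
  exact ⟨I, hI, hc, h.symm⟩

/-- Enlarge `K` to two elements inside `J`; all that is discarded has nonpositive weight. -/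
theorem exists_isIndepSet_card_two_of_nonpos {J : Finset V} (hJ : G.IsIndepSet ↑J)
    (hw : ∃ K ⊆ J, K.card ≤ 2 ∧ ∀ i ∈ J, i ∉ K → w i ≤ 0) (h2 : 2 ≤ J.card) :
    ∃ I : Finset V, G.IsIndepSet ↑I ∧ I.card = 2 ∧ ∑ i ∈ J, w i ≤ ∑ i ∈ I, w i := by
  classical
  obtain ⟨K, hKJ, hK, hw⟩ := hw
  obtain ⟨I, hKI, hIJ, hI⟩ := Finset.exists_subsuperset_card_eq hKJ hK h2
  refine ⟨I, hJ.mono (Finset.coe_subset.2 hIJ), hI, ?_⟩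
  rw [← Finset.sum_sdiff hIJ]
  have : ∑ i ∈ J \ I, w i ≤ 0 := Finset.sum_nonpos fun i hi => by
    obtain ⟨hi1, hi2⟩ := Finset.mem_sdiff.1 hi
    exact hw i hi1 fun h => hi2 (hKI h)
  omega

end Weight

/-- Two vertices within `m` of `z` on the same side are within `m` of each other. Among three
vertices of a closed neighborhood, two are on the same side. -/
theorem not_cycleOffset_le_of_lt {n m : ℕ} {x y z : Fin n} (h : m < cycleOffset x y)
    (h' : m < cycleOffset y x) :
    ¬ (cycleOffset z x ≤ m ∧ cycleOffset z y ≤ m) ∧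
      ¬ (cycleOffset x z ≤ m ∧ cycleOffset y z ≤ m) := by
  have := x.2
  have := y.2
  have := z.2
  constructor <;> rintro ⟨h1, h2⟩ <;> unfold cycleOffset at * <;> split_ifs at * <;> omega

/-- The closed neighborhood of a vertex of the power of a cycle contains at most two vertices of an
independent set. -/
theorem exists_notMem_closedNbhd {n m : ℕ} {J : Finset (Fin n)}
    (hJ : (cyclePower n m).IsIndepSet ↑J) (h3 : 3 ≤ J.card) (i : Fin n) :
    ∃ j ∈ J, j ≠ i ∧ ¬ (cyclePower n m).Adj i j := by
  obtain ⟨a, b, c, ha, hb, hc, hab, hac, hbc⟩ := Finset.two_lt_card_iff.1 h3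
  have h1 := lt_cycleOffset_of_isIndepSet hJ ha hb hab
  have h2 := lt_cycleOffset_of_isIndepSet hJ hb ha hab.symm
  have h3 := lt_cycleOffset_of_isIndepSet hJ ha hc hac
  have h4 := lt_cycleOffset_of_isIndepSet hJ hc ha hac.symm
  have h5 := lt_cycleOffset_of_isIndepSet hJ hb hc hbc
  have h6 := lt_cycleOffset_of_isIndepSet hJ hc hb hbc.symm
  by_contra hno
  push Not at hno
  have key : ∀ j ∈ J, j ∈ closedNbhd (cyclePower n m) i := fun j hj => by
    rw [mem_closedNbhd]
    by_cases hji : j = i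
    · exact Or.inl hji
    · exact Or.inr (hno j hj hji)
  have ka := mem_closedNbhd_cyclePower.1 (key a ha)
  have kb := mem_closedNbhd_cyclePower.1 (key b hb)
  have kc := mem_closedNbhd_cyclePower.1 (key c hc)
  have n1 := not_cycleOffset_le_of_lt (z := i) h1 h2
  have n2 := not_cycleOffset_le_of_lt (z := i) h3 h4
  have n3 := not_cycleOffset_le_of_lt (z := i) h5 h6
  omega

theorem grundyNumber_xJoin_cyclePower (n m : ℕ) (hm : 1 ≤ m) (hn : 2 * (m + 1) ≤ n)
    (V : Fin n → Type*) [∀ i, Finite (V i)] [∀ i, Nonempty (V i)]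
    (R : ∀ i, SimpleGraph (V i)) (w : Fin n → ℤ)
    (hw : ∀ i, w i = (grundyNumber (R i) : ℤ) - ((m : ℤ) + 1))
    (I : Finset (Fin n)) (hI : (cyclePower n m).IsIndepSet ↑I)
    (hmax : ∑ i ∈ I, w i = alphaWeight (cyclePower n m) w) :
    (2 ≤ I.card → (grundyNumber (xJoin (cyclePower n m) R) : ℤ) =
        alphaWeight (cyclePower n m) w + n) ∧
      (¬ 2 ≤ I.card → (grundyNumber (xJoin (cyclePower n m) R) : ℤ) =
        alphaWeightTwo (cyclePower n m) w + n) := by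
  have hsum : ∀ J : Finset (Fin n),
      ∑ i ∈ J, w i = (∑ i ∈ J, grundyNumber (R i) : ℕ) - (J.card * (m + 1) : ℕ) := by
    intro J
    rw [Finset.sum_congr rfl fun i _ => hw i, Finset.sum_sub_distrib, Finset.sum_const]
    push_cast
    rw [nsmul_eq_mul]
  have hlow : ∀ J : Finset (Fin n), (cyclePower n m).IsIndepSet ↑J → 2 ≤ J.card →
      ∑ i ∈ J, w i + n ≤ grundyNumber (xJoin (cyclePower n m) R) := by
    intro J hJ h2
    have := le_grundyNumber_xJoin (R := R) hm hn hJ h2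
    rw [hsum J]
    omega
  obtain ⟨J, hJ, hJ2, hup⟩ := exists_isIndepSet_grundyNumber_xJoin_le (R := R) hn
  have hup' : (grundyNumber (xJoin (cyclePower n m) R) : ℤ) ≤ ∑ i ∈ J, w i + n := by
    rw [hsum J]
    omega
  refine ⟨fun h2 => ?_, fun h2 => ?_⟩
  · have h1 := hlow I hI h2
    have h3 := sum_le_alphaWeight (w := w) hJ
    omega
  · obtain ⟨K, hK, hK2, hle⟩ : ∃ K : Finset (Fin n), (cyclePower n m).IsIndepSet ↑K ∧
        K.card = 2 ∧ ∑ i ∈ J, w i ≤ ∑ i ∈ K, w i := by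
      -- Either at most two members of `J` have positive weight and the others can be dropped, or
      -- three do. In that case one of them is outside the closed neighborhood of the at most one
      -- vertex of `I`, and adding it to `I` contradicts maximality.
      by_cases hP : ∃ K ⊆ J, K.card ≤ 2 ∧ ∀ i ∈ J, i ∉ K → w i ≤ 0
      · exact exists_isIndepSet_card_two_of_nonpos hJ hP hJ2
      · exfalso
        set P := J.filter fun i => 0 < w i with hPdef
        have hP3 : 3 ≤ P.card := by
          by_contra h
          refine hP ⟨P, Finset.filter_subset _ _, by omega, fun i hi hiP => ?_⟩
          by_contra hpos
          exact hiP (Finset.mem_filter.2 ⟨hi, by omega⟩)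
        have hPI : (cyclePower n m).IsIndepSet ↑P :=
          hJ.mono (Finset.coe_subset.2 (Finset.filter_subset _ _))
        obtain ⟨j, hjP, hj⟩ : ∃ j ∈ P, j ∉ I ∧ ∀ i ∈ I, ¬ (cyclePower n m).Adj i j := by
          rcases I.eq_empty_or_nonempty with rfl | ⟨i, hi⟩
          · obtain ⟨j, hj⟩ := Finset.card_pos.1 (by omega : 0 < P.card)
            exact ⟨j, hj, by simp, by simp⟩
          · have hIi : I = {i} := Finset.eq_singleton_iff_unique_mem.2
              ⟨hi, fun x hx => Finset.card_le_one.1 (by omega) x hx i hi⟩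
            obtain ⟨j, hj, hji, hadj⟩ := exists_notMem_closedNbhd hPI hP3 i
            exact ⟨j, hj, by simpa [hIi] using hji, by simpa [hIi] using hadj⟩
        have hins : (cyclePower n m).IsIndepSet ↑(insert j I) := by
          rw [Finset.coe_insert, SimpleGraph.IsIndepSet, Set.pairwise_insert]
          exact ⟨hI, fun i hi _ => ⟨fun h => hj.2 i hi h.symm, hj.2 i hi⟩⟩
        have h4 := sum_le_alphaWeight (w := w) hins
        rw [Finset.sum_insert hj.1] at h4
        have := (Finset.mem_filter.1 hjP).2
        omega
    obtain ⟨K', hK', hK2', h⟩ := exists_sum_eq_alphaWeightTwo (w := w) hK hK2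
    have h3 := sum_le_alphaWeightTwo (w := w) hK hK2
    have h4 := hlow K' hK' hK2'.ge
    omega

/-! ### Running times of random access programs -/

/-- A bound on the running time, as a polynomial in a bound on the number of iterations of each
single loop. -/
noncomputable def RamProg.timeBound : RamProg → Polynomial ℕ
  | .skip => 1
  | .assign _ e => Polynomial.C (e.cost + 1)
  | .write _ e f => Polynomial.C (e.cost + f.cost + 1)
  | .seq p q => p.timeBound + q.timeBound
  | .cond e p q => Polynomial.C (e.cost + 1) + p.timeBound + q.timeBound
  | .loop e p => (Polynomial.X + 1) * (Polynomial.C (e.cost + 1) + p.timeBound)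

/-- Started in `s`, the program `p` halts in a state with property `P`, within the time that it
takes if no loop has more than `M` iterations. -/
def RamProg.Runs (M : ℕ) (p : RamProg) (s : RamState) (P : RamState → Prop) : Prop :=
  ∃ s' t, RamExec p s s' t ∧ t ≤ p.timeBound.eval M ∧ P s'

namespace RamProg.Runs

variable {M : ℕ} {p q : RamProg} {e f : RamExpr} {s : RamState} {P Q : RamState → Prop}

theorem mono (h : Runs M p s Q) (hQ : ∀ s', Q s' → P s') : Runs M p s P := by
  obtain ⟨s', t, h1, h2, h3⟩ := h
  exact ⟨s', t, h1, h2, hQ s' h3⟩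

theorem skip (h : P s) : Runs M .skip s P :=
  ⟨s, _, .skip s, by simp [timeBound], h⟩

theorem assign {x : ℕ} (h : P ⟨Function.update s.var x (e.eval s), s.arr⟩) :
    Runs M (.assign x e) s P :=
  ⟨_, _, .assign s x e, by simp [timeBound], h⟩

theorem write {a : ℕ}
    (h : P ⟨s.var, Function.update s.arr a (Function.update (s.arr a) (e.eval s) (f.eval s))⟩) :
    Runs M (.write a e f) s P :=
  ⟨_, _, .write s a e f, by simp [timeBound], h⟩

theorem seq (h : Runs M p s fun s' => Runs M q s' P) : Runs M (.seq p q) s P := by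
  obtain ⟨s₁, t₁, h₁, hb₁, s₂, t₂, h₂, hb₂, hP⟩ := h
  refine ⟨s₂, _, .seq h₁ h₂, ?_, hP⟩
  rw [timeBound, Polynomial.eval_add]
  omega

theorem cond (h₁ : e.eval s ≠ 0 → Runs M p s P) (h₂ : e.eval s = 0 → Runs M q s P) :
    Runs M (.cond e p q) s P := by
  by_cases he : e.eval s = 0
  · obtain ⟨s', t, h, hb, hP⟩ := h₂ he
    refine ⟨s', _, .condFalse he h, ?_, hP⟩
    simp only [timeBound, Polynomial.eval_add, Polynomial.eval_C]
    omega
  · obtain ⟨s', t, h, hb, hP⟩ := h₁ he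
    refine ⟨s', _, .condTrue he h, ?_, hP⟩
    simp only [timeBound, Polynomial.eval_add, Polynomial.eval_C]
    omega

/-- `Inv k` is an invariant under which at most `k` iterations remain. -/
theorem loop (Inv : ℕ → RamState → Prop)
    (hstep : ∀ k s, Inv k s → e.eval s ≠ 0 → Runs M p s fun s' => ∃ k' < k, Inv k' s')
    (hdone : ∀ k s, Inv k s → e.eval s = 0 → P s) {k : ℕ} (hk : k ≤ M) (h : Inv k s) :
    Runs M (.loop e p) s P := by
  -- The summand `e.cost + 1` pays for the last test, which ends the loop.
  have key : ∀ k s, Inv k s → ∃ s' t, RamExec (.loop e p) s s' t ∧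
      t ≤ k * (e.cost + 1 + p.timeBound.eval M) + (e.cost + 1) ∧ P s' := by
    intro k
    induction k using Nat.strong_induction_on with
    | _ k ih =>
      intro s hs
      by_cases he : e.eval s = 0
      · exact ⟨s, _, .loopDone he, by omega, hdone k s hs he⟩
      · obtain ⟨s₁, t₁, h₁, hb₁, k', hk', hs₁⟩ := hstep k s hs he
        obtain ⟨s₂, t₂, h₂, hb₂, hP⟩ := ih k' hk' s₁ hs₁
        refine ⟨s₂, _, .loopStep he h₁ h₂, ?_, hP⟩
        have := Nat.mul_le_mul_right (e.cost + 1 + p.timeBound.eval M) (Nat.succ_le_of_lt hk')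
        rw [Nat.succ_mul] at this
        omega
  obtain ⟨s', t, ht, hb, hP⟩ := key k s h
  refine ⟨s', t, ht, hb.trans ?_, hP⟩
  have := Nat.mul_le_mul_right (e.cost + 1 + p.timeBound.eval M) hk
  simp only [timeBound, Polynomial.eval_add, Polynomial.eval_mul, Polynomial.eval_C,
    Polynomial.eval_X, Polynomial.eval_one, add_mul (M : ℕ) 1, one_mul]
  omega

end RamProg.Runs

/-- The nesting of loops is fixed by the program, so it is enough that each single loop has at most
as many iterations as the input has bits. -/
theorem polyTimeSolvable_of_runs {ι : Type*} {encode : ι → List ℕ}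
    {IsSolution : ι → List ℕ → Prop} (p : RamProg)
    (h : ∀ x, p.Runs (bitLength (encode x)) (ramInit (encode x))
      fun s => IsSolution x (ramOutput s)) :
    PolyTimeSolvable encode IsSolution :=
  ⟨p, p.timeBound, h⟩

/-! ### The program -/

namespace RamExpr

/-- The maximum of two expressions. -/
def maximum (e f : RamExpr) : RamExpr := .add e (.sub f e)

theorem eval_maximum (s : RamState) (e f : RamExpr) :
    (maximum e f).eval s = max (e.eval s) (f.eval s) := by
  simp only [maximum, eval]
  omega

end RamExpr

namespace CycleJoinProgram

/-- Append the values of two expressions to the output. -/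
def emit (e f : RamExpr) : RamProg :=
  .seq (.write 1 (.var 1) e) <| .seq (.write 1 (.add (.var 1) (.const 1)) f) <|
    .assign 1 (.add (.var 1) (.const 2))

/-- The address `x₄ + x₅` of the current graph in the doubled arrays. -/
def here : RamExpr := .add (.var 4) (.var 5)

/-- Read `n`, `m` into `x₂`, `x₃`, and for `i < 2n` the length and the start of the sequence
`i mod n` and the number `i mod n` into `A₂[i]`, `A₃[i]`, `A₄[i]`. -/
def parse : RamProg :=
  .seq (.assign 2 (.read 0 (.const 0))) <| .seq (.assign 3 (.read 0 (.const 1))) <|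
  .seq (.assign 7 (.const 2)) <| .loop (.sub (.var 2) (.var 5)) <|
    .seq (.write 2 (.var 5) (.read 0 (.var 7))) <|
    .seq (.write 2 (.add (.var 5) (.var 2)) (.read 0 (.var 7))) <|
    .seq (.write 3 (.var 5) (.add (.var 7) (.const 1))) <|
    .seq (.write 3 (.add (.var 5) (.var 2)) (.add (.var 7) (.const 1))) <|
    .seq (.write 4 (.var 5) (.var 5)) <|
    .seq (.write 4 (.add (.var 5) (.var 2)) (.var 5)) <|
    .seq (.assign 7 (.add (.add (.var 7) (.const 1)) (.read 0 (.var 7)))) <|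
    .assign 5 (.add (.var 5) (.const 1))

/-- The value of playing all other vertices back from `x₄` and then the sequence here. -/
def finishValue : RamExpr :=
  .add (.read 2 here) (.sub (.var 2) (.add (.add (.var 5) (.var 3)) (.const 1)))

/-- The value of dominating the offset `x₅` by a single vertex. -/
def stepValue : RamExpr := .add (.const 1) (.read 5 (.add (.var 5) (.const 1)))

/-- The value of playing the sequence here. -/
def jumpValue : RamExpr :=
  .add (.read 2 here) (.read 5 (.add (.add (.var 5) (.var 3)) (.const 1)))

/-- Write `playValue` for the start `x₄` into `A₅`. -/
def fill : RamProg :=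
  .seq (.assign 5 (.sub (.var 2) (.add (.var 3) (.const 1)))) <|
  .loop (.sub (.var 5) (.var 3)) <|
    .seq (.write 5 (.var 5) (.maximum (.maximum finishValue stepValue) jumpValue)) <|
    .assign 5 (.sub (.var 5) (.const 1))

/-- Find a start with the largest value. -/
def search : RamProg :=
  .loop (.sub (.var 2) (.var 4)) <|
    .seq fill <|
    .seq (.assign 10 (.add (.read 2 (.var 4)) (.read 5 (.add (.var 3) (.const 1))))) <|
    .seq (.cond (.sub (.var 10) (.var 8))
      (.seq (.assign 8 (.var 10)) (.assign 9 (.var 4))) .skip) <|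
    .assign 4 (.add (.var 4) (.const 1))

/-- Output the sequence here. -/
def copy : RamProg :=
  .seq (.assign 6 (.const 0)) <|
  .loop (.sub (.read 2 here) (.var 6)) <|
    .seq (emit (.read 4 here) (.read 0 (.add (.read 3 here) (.var 6)))) <|
    .assign 6 (.add (.var 6) (.const 1))

/-- Output the vertices played back from `x₄`. -/
def back : RamProg :=
  .seq (.assign 6 (.var 2)) <|
  .loop (.sub (.var 6) (.add (.add (.var 5) (.var 3)) (.const 1))) <|
    .seq (.assign 6 (.sub (.var 6) (.const 1))) <|
    emit (.read 4 (.add (.var 4) (.var 6))) (.const 0)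

/-- Output the play from `x₅` on. -/
def play : RamProg :=
  .loop (.sub (.var 2) (.add (.var 5) (.var 3))) <|
    .cond (.add (.sub stepValue finishValue) (.sub jumpValue finishValue))
      (.cond (.sub jumpValue stepValue)
        (.seq copy <| .assign 5 (.add (.add (.var 5) (.var 3)) (.const 1)))
        (.seq (emit (.read 4 (.add (.var 4) (.sub (.var 5) (.var 3)))) (.const 0)) <|
          .assign 5 (.add (.var 5) (.const 1))))
      (.seq back <| .seq copy <| .assign 5 (.var 2))

/-- The whole program. -/
def main : RamProg :=
  .seq parse <| .seq search <| .seq (.assign 4 (.var 9)) <| .seq fill <|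
  .seq (.assign 5 (.const 0)) <| .seq copy <|
  .seq (.assign 5 (.add (.var 3) (.const 1))) play

end CycleJoinProgram

/-! ### Correctness of the program -/

/-- The list of numbers that represents a sequence of vertices of a join. -/
def encodeVertices {n : ℕ} {k : Fin n → ℕ} (T : List (Σ i, Fin (k i))) : List ℕ :=
  T.flatMap fun a => [(a.1 : ℕ), (a.2 : ℕ)]

theorem encodeVertices_cons {n : ℕ} {k : Fin n → ℕ} (a : Σ i, Fin (k i))
    (T : List (Σ i, Fin (k i))) :
    encodeVertices (a :: T) = [(a.1 : ℕ), (a.2 : ℕ)] ++ encodeVertices T := rfl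

theorem encodeVertices_append {n : ℕ} {k : Fin n → ℕ} (T U : List (Σ i, Fin (k i))) :
    encodeVertices (T ++ U) = encodeVertices T ++ encodeVertices U :=
  List.flatMap_append

/-- The states that agree except for the output and the variable `x₆`. -/
def SameInput (s s' : RamState) : Prop :=
  (∀ a, a ≠ 1 → s'.arr a = s.arr a) ∧ ∀ y, y ≠ 1 → y ≠ 6 → s'.var y = s.var y

theorem SameInput.trans {s₁ s₂ s₃ : RamState} (h : SameInput s₁ s₂) (h' : SameInput s₂ s₃) :
    SameInput s₁ s₃ :=
  ⟨fun a ha => (h'.1 a ha).trans (h.1 a ha), fun y h1 h6 => (h'.2 y h1 h6).trans (h.2 y h1 h6)⟩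

namespace CycleJoinProgram

/-- The program has read the input of the instance `x`. -/
structure Loaded (x : CycleJoinInstance) (s : RamState) : Prop where
  n : s.var 2 = x.n
  m : s.var 3 = x.m
  len : ∀ (i : Fin x.n) (d : ℕ), d < x.n → s.arr 2 (i + d) = offsetLength x.S i d
  idx : ∀ (i : Fin x.n) (d : ℕ), d < x.n → s.arr 4 (i + d) = cycleShift i d
  data : ∀ (i : Fin x.n) (d : ℕ), d < x.n → ∀ (k : ℕ) (hk : k < (x.S (cycleShift i d)).length),
    s.arr 0 (s.arr 3 (i + d) + k) = ((x.S (cycleShift i d))[k] : ℕ)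

theorem Loaded.congr {x : CycleJoinInstance} {s s' : RamState} (h : Loaded x s)
    (h2 : s'.var 2 = s.var 2) (h3 : s'.var 3 = s.var 3)
    (ha : ∀ a, a ≠ 1 → a ≠ 5 → s'.arr a = s.arr a) : Loaded x s' := by
  constructor
  · rw [h2, h.n]
  · rw [h3, h.m]
  · rw [ha 2 (by decide) (by decide)]
    exact h.len
  · rw [ha 4 (by decide) (by decide)]
    exact h.idx
  · rw [ha 0 (by decide) (by decide), ha 3 (by decide) (by decide)]
    exact h.data

theorem Loaded.of_sameInput {x : CycleJoinInstance} {s s' : RamState} (h : Loaded x s)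
    (h' : SameInput s s') : Loaded x s' :=
  h.congr (h'.2 2 (by decide) (by decide)) (h'.2 3 (by decide) (by decide)) fun a h1 _ => h'.1 a h1

variable {M : ℕ} {P : RamState → Prop}

/-- The value of `f` is computed after `e` has been written, so it must not depend on the output
array. -/
theorem runs_emit {s : RamState} {e f : RamExpr} {u v : ℕ} (he : e.eval s = u)
    (hf : ∀ s', s'.var = s.var → (∀ a, a ≠ 1 → s'.arr a = s.arr a) → f.eval s' = v)
    (h : ∀ s', (∀ a, a ≠ 1 → s'.arr a = s.arr a) → (∀ y, y ≠ 1 → s'.var y = s.var y) →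
      ramOutput s' = ramOutput s ++ [u, v] → P s') :
    (emit e f).Runs M s P := by
  refine .seq (.write (.seq (.write (.assign (h _ ?_ ?_ ?_)))))
  · intro a ha
    simp [Function.update_of_ne ha]
  · intro y hy
    simp [Function.update_of_ne hy]
  · have hv := hf ⟨s.var, Function.update s.arr 1 (Function.update (s.arr 1) (s.var 1) u)⟩ rfl
      fun a ha => by simp [Function.update_of_ne ha]
    simp only [ramOutput, RamExpr.eval, Function.update_self, he, hv]
    rw [List.range_succ, List.range_succ, List.map_append, List.map_append, List.append_assoc]
    congr 1
    · refine List.map_congr_left fun k hk => ?_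
      have := List.mem_range.1 hk
      rw [Function.update_of_ne (by omega), Function.update_of_ne (by omega)]
    · simp

variable {x : CycleJoinInstance}

theorem runs_copy {s : RamState} (hs : Loaded x s) {i : Fin x.n} {c : ℕ} (hi : s.var 4 = i)
    (hc : s.var 5 = c) (hcn : c < x.n) (hM : ∀ j, (x.S j).length ≤ M)
    (h : ∀ s', SameInput s s' →
      ramOutput s' = ramOutput s ++ encodeVertices (joinBlock x.S (cycleShift i c)) → P s') :
    copy.Runs M s P := by
  refine .seq (.assign ?_)
  -- The output so far, followed by what is still to be written, does not change.
  refine .loop (fun k s' => SameInput s s' ∧ ∃ l, s'.var 6 = l ∧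
    l + k = (x.S (cycleShift i c)).length ∧
    ramOutput s' ++ encodeVertices (((x.S (cycleShift i c)).drop l).map (Sigma.mk _)) =
      ramOutput s ++ encodeVertices (joinBlock x.S (cycleShift i c)))
    ?_ ?_ (hM (cycleShift i c)) ?_
  · rintro k s' ⟨hss, l, hl, hk, hout⟩ he
    have hs' := hs.of_sameInput hss
    have hi' : s'.var 4 = i := (hss.2 4 (by decide) (by decide)).trans hi
    have hc' : s'.var 5 = c := (hss.2 5 (by decide) (by decide)).trans hc
    have hlen := hs'.len i c hcn
    simp only [RamExpr.eval, here, hi', hc', hlen, offsetLength, hl] at he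
    have hlt : l < (x.S (cycleShift i c)).length := by omega
    refine .seq (runs_emit (u := (cycleShift i c : ℕ)) (v := ((x.S (cycleShift i c))[l] : ℕ))
      ?_ ?_ fun s'' harr hvar hout' => .assign ⟨k - 1, by omega, ?_, l + 1, ?_, by omega, ?_⟩)
    · simp only [RamExpr.eval, here, hi', hc', hs'.idx i c hcn]
    · intro t ht hta
      simp only [RamExpr.eval, here, ht, hi', hc', hl, hta 0 (by decide), hta 3 (by decide)]
      exact hs'.data i c hcn l hlt
    · refine hss.trans ⟨harr, fun y h1 h6 => ?_⟩
      simp only [Function.update_of_ne h6]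
      exact hvar y h1
    · simp [RamExpr.eval, hvar 6 (by decide), hl]
    · rw [← hout, List.drop_eq_getElem_cons hlt, List.map_cons, encodeVertices_cons,
        ← List.append_assoc]
      congr 1
  · rintro k s' ⟨hss, l, hl, hk, hout⟩ he
    have hs' := hs.of_sameInput hss
    have hi' : s'.var 4 = i := (hss.2 4 (by decide) (by decide)).trans hi
    have hc' : s'.var 5 = c := (hss.2 5 (by decide) (by decide)).trans hc
    have hlen := hs'.len i c hcn
    simp only [RamExpr.eval, here, hi', hc', hlen, offsetLength, hl] at he
    refine h s' hss ?_
    rw [← hout, List.drop_eq_nil_of_le (by omega)]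
    simp [encodeVertices]
  · refine ⟨⟨fun _ _ => rfl, fun y _ h6 => ?_⟩, 0, ?_, by simp, rfl⟩
    · simp [Function.update_of_ne h6]
    · simp [RamExpr.eval]

/-- The vertex of each graph that the program plays on its own. -/
def firstVertex (x : CycleJoinInstance) (i : Fin x.n) : Fin (x.order i) := ⟨0, x.order_pos i⟩

theorem runs_back {s : RamState} (hs : Loaded x s) {i : Fin x.n} {c : ℕ} (hi : s.var 4 = i)
    (hc : s.var 5 = c) (hcn : c + x.m + 1 ≤ x.n) (hM : x.n ≤ M)
    (h : ∀ s', SameInput s s' → ramOutput s' = ramOutput s ++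
      encodeVertices (backPlays (firstVertex x) i (c + x.m + 1) (x.n - (c + x.m + 1))) → P s') :
    back.Runs M s P := by
  refine .seq (.assign ?_)
  refine .loop (k := x.n - (c + x.m + 1)) (fun k s' => SameInput s s' ∧
    s'.var 6 = c + x.m + 1 + k ∧ c + x.m + 1 + k ≤ x.n ∧
    ramOutput s' ++ encodeVertices (backPlays (firstVertex x) i (c + x.m + 1) k) =
      ramOutput s ++
        encodeVertices (backPlays (firstVertex x) i (c + x.m + 1) (x.n - (c + x.m + 1))))
    ?_ ?_ (by omega) ?_
  · rintro k s' ⟨hss, h6, hk, hout⟩ he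
    have hs' := hs.of_sameInput hss
    have hi' : s'.var 4 = i := (hss.2 4 (by decide) (by decide)).trans hi
    have hc' : s'.var 5 = c := (hss.2 5 (by decide) (by decide)).trans hc
    simp only [RamExpr.eval, hc', hs'.m, h6] at he
    obtain ⟨k, rfl⟩ := Nat.exists_eq_add_one_of_ne_zero (n := k) (by omega)
    refine .seq (.assign (runs_emit (u := (cycleShift i (c + x.m + 1 + k) : ℕ)) (v := 0)
      ?_ ?_ fun s'' harr hvar hout' => ⟨k, by omega, ?_, ?_, by omega, ?_⟩))
    · simp only [RamExpr.eval, Function.update_self, h6]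
      rw [Function.update_of_ne (by decide), hi']
      exact hs'.idx i _ (by omega)
    · intro t _ _
      rfl
    · refine hss.trans ⟨harr, fun y h1 h6 => ?_⟩
      rw [hvar y h1]
      simp only [Function.update_of_ne h6]
    · rw [hvar 6 (by decide)]
      simp only [RamExpr.eval, Function.update_self, h6]
      omega
    · rw [← hout, hout', backPlays, encodeVertices_cons, ← List.append_assoc]
      rfl
  · rintro k s' ⟨hss, h6, hk, hout⟩ he
    have hs' := hs.of_sameInput hss
    have hc' : s'.var 5 = c := (hss.2 5 (by decide) (by decide)).trans hc
    simp only [RamExpr.eval, hc', hs'.m, h6] at he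
    obtain rfl : k = 0 := by omega
    refine h s' hss ?_
    rw [← hout]
    simp [encodeVertices, backPlays]
  · refine ⟨⟨fun _ _ => rfl, fun y _ h6 => ?_⟩, ?_, by omega, rfl⟩
    · simp [Function.update_of_ne h6]
    · simp only [RamExpr.eval, Function.update_self, hs.n]
      omega

/-- The array `A₅` contains `playValue` for the start `i`. -/
def Filled (x : CycleJoinInstance) (i : Fin x.n) (s : RamState) : Prop :=
  ∀ c, x.m < c → s.arr 5 c = playValue x.n x.m (offsetLength x.S i) c

theorem runs_fill {s : RamState} (hs : Loaded x s) {i : Fin x.n} (hi : s.var 4 = i)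
    (h5 : ∀ c, x.n < c + x.m + 1 → s.arr 5 c = 0) (hM : x.n ≤ M)
    (h : ∀ s', Loaded x s' → Filled x i s' → (∀ a, a ≠ 5 → s'.arr a = s.arr a) →
      (∀ y, y ≠ 5 → s'.var y = s.var y) → P s') :
    fill.Runs M s P := by
  have hmn := x.le_n
  refine .seq (.assign ?_)
  -- Offsets are filled from `n - (m + 1)` down to `m + 1`. Beyond them the array holds 0, the value
  -- of `playValue` there.
  refine .loop (k := x.n - (x.m + 1) - x.m) (fun k s' => (∀ a, a ≠ 5 → s'.arr a = s.arr a) ∧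
    (∀ y, y ≠ 5 → s'.var y = s.var y) ∧ s'.var 5 = x.m + k ∧ x.m + k + x.m + 1 ≤ x.n ∧
    ∀ c, x.m + k < c → s'.arr 5 c = playValue x.n x.m (offsetLength x.S i) c)
    ?_ ?_ (by omega) ?_
  · rintro k s' ⟨harr, hvar, hk5, hk, hval⟩ he
    have hs' : Loaded x s' := hs.congr (hvar 2 (by decide)) (hvar 3 (by decide))
      fun a _ h5 => harr a h5
    have hi' : s'.var 4 = i := (hvar 4 (by decide)).trans hi
    simp only [RamExpr.eval, hs'.m, hk5] at he
    refine .seq (.write (.assign ⟨k - 1, by omega, ?_, ?_, ?_, by omega, ?_⟩))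
    · intro a ha
      simp only [Function.update_of_ne ha]
      exact harr a ha
    · intro y hy
      simp only [Function.update_of_ne hy]
      exact hvar y hy
    · simp only [RamExpr.eval, Function.update_self, hk5]
      omega
    · intro c hc
      simp only [RamExpr.eval_maximum, finishValue, stepValue, jumpValue, here, RamExpr.eval,
        Function.update_self, hs'.m, hs'.n, hi', hk5, hs'.len i (x.m + k) (by omega)]
      by_cases hck : c = x.m + k
      · rw [hck, Function.update_self, playValue_of_le hk, hval _ (by omega), hval _ (by omega)]
      · rw [Function.update_of_ne hck]
        exact hval c (by omega)
  · rintro k s' ⟨harr, hvar, hk5, hk, hval⟩ he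
    have hs' : Loaded x s' := hs.congr (hvar 2 (by decide)) (hvar 3 (by decide))
      fun a _ h5 => harr a h5
    simp only [RamExpr.eval, hs'.m, hk5] at he
    exact h s' hs' (fun c hc => hval c (by omega)) harr hvar
  · refine ⟨fun _ _ => rfl, fun y hy => ?_, ?_, by omega, fun c hc => ?_⟩
    · simp [Function.update_of_ne hy]
    · simp only [RamExpr.eval, Function.update_self, hs.n, hs.m]
      omega
    · rw [playValue_of_lt (by omega)]
      exact h5 c (by omega)

theorem runs_play {s : RamState} (hs : Loaded x s) {i : Fin x.n} (hi : s.var 4 = i)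
    (hfill : Filled x i s) (h5 : s.var 5 = x.m + 1) (hM : x.n ≤ M)
    (hM' : ∀ j, (x.S j).length ≤ M) :
    play.Runs M s fun s' => ramOutput s' = ramOutput s ++
      encodeVertices (playFrom x.m x.S (firstVertex x) i (x.m + 1)) := by
  have hmn := x.le_n
  refine .loop (k := x.n - (x.m + 1)) (fun k s' => Loaded x s' ∧ s'.var 4 = i ∧ Filled x i s' ∧
    ∃ c, s'.var 5 = c ∧ k = x.n - c ∧ x.m < c ∧
    ramOutput s' ++ encodeVertices (playFrom x.m x.S (firstVertex x) i c) = ramOutput s ++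
      encodeVertices (playFrom x.m x.S (firstVertex x) i (x.m + 1)))
    ?_ ?_ (by omega) ⟨hs, hi, hfill, _, h5, rfl, by omega, rfl⟩
  · rintro k s' ⟨hs', hi', hfill', c, hc, rfl, hmc, hout⟩ he
    simp only [RamExpr.eval, hs'.m, hs'.n, hc] at he
    have hlen := hs'.len i c (by omega)
    rw [playFrom] at hout
    simp only [if_pos (show c + x.m + 1 ≤ x.n by omega)] at hout
    -- The sum of truncated differences vanishes exactly when finishing is best. Otherwise a
    -- positive difference selects the jump, and ties go to the single play, as in `playFrom`.
    refine .cond (fun h1 => .cond (fun h2 => ?_) fun h2 => ?_) fun h1 => ?_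
    · simp only [finishValue, stepValue, jumpValue, here, RamExpr.eval, hs'.m, hs'.n, hi', hc, hlen,
        hfill' (c + 1) (by omega), hfill' (c + x.m + 1) (by omega)] at h1 h2
      rw [if_neg (by omega), if_neg (by omega)] at hout
      refine .seq (runs_copy hs' hi' hc (by omega) hM' fun t ht hto => .assign
        ⟨x.n - (c + x.m + 1), by omega, ?_, ?_, ?_, c + x.m + 1, ?_, rfl, by omega, ?_⟩)
      · exact (hs'.of_sameInput ht).congr (by simp) (by simp) fun _ _ _ => rfl
      · simpa using (ht.2 4 (by decide) (by decide)).trans hi'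
      · intro d hd
        simpa [ht.1 5 (by decide)] using hfill' d hd
      · simp [RamExpr.eval, ht.2 5 (by decide) (by decide), ht.2 3 (by decide) (by decide), hc,
          hs'.m]
      · rw [← hout, encodeVertices_append, ← List.append_assoc, ← hto]
        rfl
    · simp only [finishValue, stepValue, jumpValue, here, RamExpr.eval, hs'.m, hs'.n, hi', hc, hlen,
        hfill' (c + 1) (by omega), hfill' (c + x.m + 1) (by omega)] at h1 h2
      rw [if_neg (by omega), if_pos (by omega)] at hout
      refine .seq (runs_emit (u := (cycleShift i (c - x.m) : ℕ)) (v := 0) ?_ ?_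
        fun t hta htv hto => .assign
        ⟨x.n - (c + 1), by omega, ?_, ?_, ?_, c + 1, ?_, rfl, by omega, ?_⟩)
      · simp only [RamExpr.eval, hi', hc, hs'.m]
        exact hs'.idx i (c - x.m) (by omega)
      · intro t _ _
        rfl
      · exact hs'.congr (by simp [htv 2]) (by simp [htv 3]) fun a ha _ => hta a ha
      · simpa using (htv 4 (by decide)).trans hi'
      · intro d hd
        simpa [hta 5 (by decide)] using hfill' d hd
      · simp [RamExpr.eval, htv 5 (by decide), hc]
      · rw [← hout, encodeVertices_cons, ← List.append_assoc]
        exact congrArg (· ++ _) hto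
    · simp only [finishValue, stepValue, jumpValue, here, RamExpr.eval, hs'.m, hs'.n, hi', hc, hlen,
        hfill' (c + 1) (by omega), hfill' (c + x.m + 1) (by omega)] at h1
      rw [if_pos (by omega)] at hout
      refine .seq (runs_back hs' hi' hc (by omega) hM fun t ht hto => ?_)
      have hi'' : t.var 4 = i := (ht.2 4 (by decide) (by decide)).trans hi'
      have hc' : t.var 5 = c := (ht.2 5 (by decide) (by decide)).trans hc
      refine .seq (runs_copy (hs'.of_sameInput ht) hi'' hc' (by omega) hM' fun t' ht' hto' =>
        .assign ⟨x.n - x.n, by omega, ?_, ?_, ?_, x.n, ?_, rfl, by omega, ?_⟩)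
      · exact (hs'.of_sameInput (ht.trans ht')).congr (by simp) (by simp) fun _ _ _ => rfl
      · simpa using (ht'.2 4 (by decide) (by decide)).trans hi''
      · intro d hd
        simpa [(ht.trans ht').1 5 (by decide)] using hfill' d hd
      · simp [RamExpr.eval, (ht.trans ht').2 2 (by decide) (by decide), hs'.n]
      · rw [← hout, encodeVertices_append, ← List.append_assoc, ← hto, ← hto', playFrom,
          if_neg (by omega)]
        simp [encodeVertices, ramOutput]
  · rintro k s' ⟨hs', hi', hfill', c, hc, rfl, hmc, hout⟩ he
    simp only [RamExpr.eval, hs'.m, hs'.n, hc] at he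
    rw [← hout, playFrom, if_neg (by omega)]
    simp [encodeVertices]

end CycleJoinProgram

/-! ### The encoded input and its size. -/

theorem length_le_bitLength (l : List ℕ) : l.length ≤ bitLength l := by
  induction l with
  | nil => simp
  | cons a l ih =>
    rw [bitLength, List.map_cons, List.sum_cons, List.length_cons]
    rw [bitLength] at ih
    omega

theorem cycleShift_of_lt {n : ℕ} (i : Fin n) {d : ℕ} (h : i + d < n) :
    cycleShift i d = ⟨i + d, h⟩ :=
  Fin.ext (Nat.mod_eq_of_lt h)

theorem cycleShift_of_le {n : ℕ} (i : Fin n) {d : ℕ} (h : n ≤ i + d) (hd : d < n) :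
    cycleShift i d = ⟨i + d - n, by have := i.2; omega⟩ := by
  have := i.2
  refine Fin.ext ?_
  simp only [cycleShift]
  rw [Nat.mod_eq_sub_mod h, Nat.mod_eq_of_lt (by omega)]

theorem cycleShift_zero {n : ℕ} (i : Fin n) : cycleShift i 0 = i := by
  rw [cycleShift_of_lt i (by simp)]
  rfl

namespace CycleJoinInstance

variable (x : CycleJoinInstance)

/-- The part of the input that describes the sequence `i`. -/
def block (i : Fin x.n) : List ℕ := (x.S i).length :: (x.S i).map Fin.val

theorem encode_eq : x.encode = [x.n, x.m] ++ (List.finRange x.n).flatMap x.block := by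
  have : x.block = fun i => (x.S i).length :: (x.S i).map Fin.val := rfl
  rw [this]
  simp [encode, List.map_eq_flatMap]

/-- The position of the part that describes the sequence `i`. -/
def blockStart (i : ℕ) : ℕ := 2 + (((List.finRange x.n).take i).flatMap x.block).length

theorem encode_eq_append (i : Fin x.n) : ∃ pre post : List ℕ,
    x.encode = pre ++ (x.block i ++ post) ∧ pre.length = x.blockStart i := by
  refine ⟨[x.n, x.m] ++ ((List.finRange x.n).take i).flatMap x.block,
    ((List.finRange x.n).drop (i + 1)).flatMap x.block, ?_, ?_⟩
  · rw [encode_eq, List.append_assoc]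
    refine congrArg ([x.n, x.m] ++ ·) ?_
    conv_lhs => rw [← List.take_append_drop i (List.finRange x.n)]
    rw [List.drop_eq_getElem_cons (by simp), List.flatMap_append, List.flatMap_cons,
      List.getElem_finRange]
    rfl
  · rw [List.length_append]
    rfl

theorem encode_getD_blockStart (i : Fin x.n) :
    x.encode.getD (x.blockStart i) 0 = (x.S i).length := by
  obtain ⟨pre, post, h, hl⟩ := x.encode_eq_append i
  rw [h, ← hl, List.getD_append_right _ _ _ _ le_rfl]
  simp [block]

theorem encode_getD_blockStart_add (i : Fin x.n) (k : ℕ) (hk : k < (x.S i).length) :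
    x.encode.getD (x.blockStart i + 1 + k) 0 = ((x.S i)[k] : ℕ) := by
  obtain ⟨pre, post, h, hl⟩ := x.encode_eq_append i
  rw [h, ← hl, List.getD_append_right _ _ _ _ (by omega),
    show pre.length + 1 + k - pre.length = k + 1 by omega, block, List.cons_append,
    List.getD_cons_succ, List.getD_append _ _ _ _ (by simpa using hk)]
  simp [hk]

theorem blockStart_succ (i : Fin x.n) :
    x.blockStart (i + 1) = x.blockStart i + 1 + (x.S i).length := by
  rw [blockStart, blockStart, List.take_succ_eq_append_getElem (by simp)]
  simp [block]
  omega

theorem n_le_length_encode : x.n ≤ x.encode.length := by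
  have : ∀ l : List (Fin x.n), l.length ≤ (l.flatMap x.block).length := by
    intro l
    induction l with
    | nil => simp
    | cons a l ih =>
      rw [List.flatMap_cons, List.length_append, List.length_cons, block, List.length_cons]
      omega
  have h := this (List.finRange x.n)
  rw [List.length_finRange] at h
  rw [encode_eq, List.length_append]
  exact h.trans (Nat.le_add_left _ _)

theorem length_S_le_length_encode (i : Fin x.n) : (x.S i).length ≤ x.encode.length := by
  obtain ⟨pre, post, h, -⟩ := x.encode_eq_append i
  rw [h]
  simp only [block, List.length_append, List.length_cons, List.length_map]
  omega

end CycleJoinInstance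

/-! ### Parsing, the search for a best start, and the whole run. -/

namespace CycleJoinProgram

variable {M : ℕ} {P : RamState → Prop} {x : CycleJoinInstance}

/-- Each array holds two copies of its `n` entries, so the address `i + d` needs no reduction modulo
`n`. -/
theorem loaded_of_forall {s : RamState} (hn : s.var 2 = x.n) (hm : s.var 3 = x.m)
    (h0 : s.arr 0 = fun j => x.encode.getD j 0)
    (h2 : ∀ j : Fin x.n, s.arr 2 j = (x.S j).length ∧ s.arr 2 (j + x.n) = (x.S j).length)
    (h3 : ∀ j : Fin x.n, s.arr 3 j = x.blockStart j + 1 ∧ s.arr 3 (j + x.n) = x.blockStart j + 1)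
    (h4 : ∀ j : Fin x.n, s.arr 4 j = j ∧ s.arr 4 (j + x.n) = j) : Loaded x s := by
  have key : ∀ (A : ℕ → ℕ) (f : Fin x.n → ℕ), (∀ j : Fin x.n, A j = f j ∧ A (j + x.n) = f j) →
      ∀ (i : Fin x.n) (d : ℕ), d < x.n → A (i + d) = f (cycleShift i d) := by
    intro A f hA i d hd
    by_cases h : i + d < x.n
    · rw [cycleShift_of_lt i h]
      exact (hA ⟨i + d, h⟩).1
    · rw [cycleShift_of_le i (not_lt.1 h) hd, ← (hA _).2]
      congr 1
      simp only
      omega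
  refine ⟨hn, hm, key _ (fun j => (x.S j).length) h2, key _ _ h4, fun i d hd k hk => ?_⟩
  rw [key _ _ h3 i d hd, h0]
  exact x.encode_getD_blockStart_add _ k hk

theorem runs_parse (hM : x.n ≤ M)
    (h : ∀ s, Loaded x s → s.arr 5 = (fun _ => 0) →
      (∀ y, y ∈ [1, 4, 8, 9] → s.var y = 0) → P s) :
    parse.Runs M (ramInit x.encode) P := by
  have henc0 : x.encode.getD 0 0 = x.n := rfl
  have henc1 : x.encode.getD 1 0 = x.m := rfl
  refine .seq (.assign (.seq (.assign (.seq (.assign ?_)))))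
  refine .loop (k := x.n) (fun k s => s.arr 0 = (fun j => x.encode.getD j 0) ∧
    s.arr 5 = (fun _ => 0) ∧ (∀ y, y ∈ [1, 4, 8, 9] → s.var y = 0) ∧ s.var 2 = x.n ∧
    s.var 3 = x.m ∧ ∃ l, s.var 5 = l ∧ l + k = x.n ∧ s.var 7 = x.blockStart l ∧
    ∀ j : Fin x.n, j < l → (s.arr 2 j = (x.S j).length ∧ s.arr 2 (j + x.n) = (x.S j).length) ∧
      (s.arr 3 j = x.blockStart j + 1 ∧ s.arr 3 (j + x.n) = x.blockStart j + 1) ∧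
      (s.arr 4 j = j ∧ s.arr 4 (j + x.n) = j))
    ?_ ?_ hM ?_
  · rintro k s ⟨h0, h5, hz, hn, hm, l, hl, hk, h7, hlt⟩ he
    simp only [RamExpr.eval, hn, hl] at he
    have hln : l < x.n := by omega
    have hread : x.encode.getD (x.blockStart l) 0 = (x.S ⟨l, hln⟩).length :=
      x.encode_getD_blockStart ⟨l, hln⟩
    refine .seq (.write (.seq (.write (.seq (.write (.seq (.write (.seq (.write (.seq (.write
      (.seq (.assign (.assign ⟨k - 1, by omega, ?_⟩))))))))))))))
    simp only [RamExpr.eval, Function.update_self, hl, h7, hn, h0, hread, Function.update_of_ne,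
      ne_eq, Nat.reduceEqDiff, not_false_eq_true, OfNat.zero_ne_ofNat]
    refine ⟨trivial, h5, ?_, trivial, hm, l + 1, rfl, by omega, ?_, ?_⟩
    · intro y hy
      have h5 : y ≠ 5 := by rintro rfl; simp at hy
      have h7 : y ≠ 7 := by rintro rfl; simp at hy
      simp only [Function.update_of_ne h5, Function.update_of_ne h7]
      exact hz y hy
    · exact (x.blockStart_succ ⟨l, hln⟩).symm
    · intro j hj
      by_cases hjl : (j : ℕ) = l
      · obtain rfl : j = ⟨l, hln⟩ := Fin.ext hjl
        simp [Function.update_apply]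
      · have h1 := hlt j (by omega)
        have h2 : (j : ℕ) ≠ l + x.n := by omega
        have h3 : (j : ℕ) + x.n ≠ l := by omega
        have h4 : (j : ℕ) + x.n ≠ l + x.n := by omega
        simp only [Function.update_of_ne h2, Function.update_of_ne h3, Function.update_of_ne h4,
          Function.update_of_ne hjl]
        exact h1
  · rintro k s ⟨h0, h5, hz, hn, hm, l, hl, hk, h7, hlt⟩ he
    simp only [RamExpr.eval, hn, hl] at he
    have hall := fun j : Fin x.n => hlt j (by omega)
    exact h s (loaded_of_forall hn hm h0 (fun j => (hall j).1) (fun j => (hall j).2.1)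
      fun j => (hall j).2.2) h5 hz
  · refine ⟨rfl, rfl, ?_, ?_, ?_, 0, ?_, by omega, ?_, fun j hj => (Nat.not_lt_zero _ hj).elim⟩
    · intro y hy
      simp only [List.mem_cons, List.not_mem_nil, or_false] at hy
      rcases hy with rfl | rfl | rfl | rfl <;> simp [ramInit]
    · simpa [RamExpr.eval, ramInit] using henc0
    · simpa [RamExpr.eval, ramInit] using henc1
    · simp [ramInit]
    · simp [RamExpr.eval, CycleJoinInstance.blockStart]

/-- The length of the sequence that is found with the start `i`. -/
def startValue (x : CycleJoinInstance) (i : Fin x.n) : ℕ :=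
  offsetLength x.S i 0 + playValue x.n x.m (offsetLength x.S i) (x.m + 1)

theorem startValue_eq (x : CycleJoinInstance) (i : Fin x.n) :
    startValue x i = (fullPlay x.m x.S (firstVertex x) i).length := by
  rw [startValue, length_fullPlay, offsetLength, cycleShift_zero]

theorem runs_search {s : RamState} (hs : Loaded x s) (h4 : s.var 4 = 0) (h8 : s.var 8 = 0)
    (h9 : s.var 9 = 0) (h5 : ∀ c, x.n < c + x.m + 1 → s.arr 5 c = 0) (hM : x.n ≤ M)
    (h : ∀ (s' : RamState) (i : Fin x.n), Loaded x s' → s'.var 1 = s.var 1 → s'.var 9 = i →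
      (∀ j, startValue x j ≤ startValue x i) → (∀ c, x.n < c + x.m + 1 → s'.arr 5 c = 0) →
      P s') :
    search.Runs M s P := by
  have hmn := x.le_n
  -- `x₈` is at least the value of every start seen and at most that of the recorded start `x₉`.
  -- This form also covers the initial zeros, before any start has been tried.
  refine .loop (k := x.n) (fun k s' => Loaded x s' ∧ s'.var 1 = s.var 1 ∧
    (∀ c, x.n < c + x.m + 1 → s'.arr 5 c = 0) ∧ ∃ (l : ℕ) (i : Fin x.n), s'.var 4 = l ∧
      l + k = x.n ∧ s'.var 9 = i ∧ s'.var 8 ≤ startValue x i ∧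
      ∀ j : Fin x.n, j < l → startValue x j ≤ s'.var 8)
    ?_ ?_ hM ?_
  · rintro k s₁ ⟨hs₁, h1, h5, l, i, hl, hk, hi, hbest, hlt⟩ he
    simp only [RamExpr.eval, hs₁.n, hl] at he
    have hln : l < x.n := by omega
    refine .seq (runs_fill (i := ⟨l, hln⟩) hs₁ hl h5 hM fun s₂ hs₂ hfill _ hvar =>
      .seq (.assign (.seq ?_)))
    have hl₂ : s₂.var 4 = l := (hvar 4 (by decide)).trans hl
    have hval : s₂.arr 2 l + s₂.arr 5 (x.m + 1) = startValue x ⟨l, hln⟩ :=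
      congrArg₂ (· + ·) (hs₂.len ⟨l, hln⟩ 0 (by omega)) (hfill _ (by omega))
    have h5' : ∀ c, x.n < c + x.m + 1 → s₂.arr 5 c = 0 := fun c hc => by
      rw [hfill c (by omega), playValue_of_lt hc]
    simp only [RamExpr.eval, hl₂, hs₂.m, hval]
    refine .cond (fun h1' => .seq (.assign (.assign (.assign ⟨k - 1, by omega, ?_, ?_, h5', l + 1,
      ⟨l, hln⟩, ?_, by omega, ?_, ?_, ?_⟩)))) fun h1' => .skip (.assign ⟨k - 1, by omega, ?_, ?_,
      h5', l + 1, i, ?_, by omega, ?_, ?_, ?_⟩)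
    · exact hs₂.congr (by simp) (by simp) fun _ _ _ => rfl
    · simpa using (hvar 1 (by decide)).trans h1
    · simp [RamExpr.eval, hl₂]
    · simp [RamExpr.eval, hl₂]
    · simp [RamExpr.eval]
    · intro j hj
      simp only [RamExpr.eval, Function.update_self, ne_eq, Nat.reduceEqDiff, not_false_eq_true,
        Function.update_of_ne, hvar 8 (by decide)] at h1' ⊢
      by_cases hjl : (j : ℕ) = l
      · exact (congrArg (startValue x) (Fin.ext hjl)).le
      · have := hlt j (by omega)
        omega
    · exact hs₂.congr (by simp) (by simp) fun _ _ _ => rfl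
    · simpa using (hvar 1 (by decide)).trans h1
    · simp [RamExpr.eval, hl₂]
    · simpa [hvar 9 (by decide)] using hi
    · simpa [hvar 8 (by decide)] using hbest
    · intro j hj
      simp only [RamExpr.eval, Function.update_self, ne_eq, Nat.reduceEqDiff, not_false_eq_true,
        Function.update_of_ne, hvar 8 (by decide)] at h1' ⊢
      by_cases hjl : (j : ℕ) = l
      · obtain rfl : j = ⟨l, hln⟩ := Fin.ext hjl
        omega
      · exact hlt j (by omega)
  · rintro k s' ⟨hs', h1, h5, l, i, hl, hk, hi, hbest, hlt⟩ he
    simp only [RamExpr.eval, hs'.n, hl] at he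
    exact h s' i hs' h1 hi (fun j => (hlt j (by omega)).trans hbest) h5
  · exact ⟨hs, rfl, h5, 0, ⟨0, by omega⟩, h4, by omega, h9, by omega,
      fun j hj => (Nat.not_lt_zero _ hj).elim⟩

theorem runs_main (hM : x.n ≤ M) (hM' : ∀ i, (x.S i).length ≤ M) :
    main.Runs M (ramInit x.encode) fun s => ∃ i, (∀ j, startValue x j ≤ startValue x i) ∧
      ramOutput s = encodeVertices (fullPlay x.m x.S (firstVertex x) i) := by
  have hmn := x.le_n
  refine .seq (runs_parse hM fun s₁ hs₁ h5 hz => ?_)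
  refine .seq (runs_search hs₁ (hz 4 (by simp)) (hz 8 (by simp)) (hz 9 (by simp)) (by simp [h5]) hM
    fun s₂ i hs₂ h1 hi hbest h5' => .seq (.assign ?_))
  refine .seq (runs_fill (i := i) (hs₂.congr (by simp) (by simp) fun _ _ _ => rfl)
    (by simpa [RamExpr.eval] using hi) h5' hM fun s₃ hs₃ hfill harr hvar => .seq (.assign ?_))
  have hi₃ : s₃.var 4 = i := by simpa [RamExpr.eval, hi] using hvar 4 (by decide)
  have h1₃ : s₃.var 1 = 0 := by simpa [h1, hz 1 (by simp)] using hvar 1 (by decide)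
  refine .seq (runs_copy (i := i) (c := 0) (hs₃.congr (by simp) (by simp) fun _ _ _ => rfl)
    (by simpa using hi₃) (by simp [RamExpr.eval]) (by omega) hM' fun s₄ hs₄ hout =>
    .seq (.assign ?_))
  refine (runs_play (i := i) ?_ ?_ ?_ ?_ hM hM').mono fun s' hs' => ⟨i, hbest, ?_⟩
  · exact (hs₃.congr (by simp [hs₄.2]) (by simp [hs₄.2]) fun a ha _ => hs₄.1 a ha)
  · simpa [hs₄.2] using hi₃
  · intro c hc
    simpa [hs₄.1 5 (by decide)] using hfill c hc
  · simp [RamExpr.eval, hs₄.2, hs₃.m]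
  · rw [hs', fullPlay, encodeVertices_append]
    congr 1
    refine Eq.trans ?_ (hout.trans ?_)
    · simp [ramOutput]
    · simp [ramOutput, h1₃, cycleShift_zero]

end CycleJoinProgram

/-- No optimal independent set is computed: every independent set with at least two vertices
contains some start, and the play from that start is at least as long as the value of the set. -/
theorem polyTimeSolvable_cycleJoin :
    PolyTimeSolvable CycleJoinInstance.encode CycleJoinInstance.IsSolution := by
  refine polyTimeSolvable_of_runs CycleJoinProgram.main fun x => ?_
  refine (CycleJoinProgram.runs_main
    (x.n_le_length_encode.trans (length_le_bitLength _))
    fun i => (x.length_S_le_length_encode i).trans (length_le_bitLength _)).mono ?_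
  rintro s ⟨i, hbest, hout⟩
  have : ∀ j, Nonempty (Fin (x.order j)) := fun j => ⟨CycleJoinProgram.firstVertex x j⟩
  refine ⟨_, isGds_xJoin_of_forall_le x.le_n
    (isLegalDomSeq_fullPlay _ (s := i) x.one_le_m x.le_n fun j => (x.isGds j).1) ?_, hout⟩
  intro I hI h2
  obtain ⟨j, hj⟩ := Finset.card_pos.1 (by omega : 0 < I.card)
  have h1 := sum_le_length_fullPlay (S := x.S) (CycleJoinProgram.firstVertex x) hI h2 hj
  have h3 := hbest j
  rw [CycleJoinProgram.startValue_eq, CycleJoinProgram.startValue_eq] at h3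
  rw [Finset.sum_congr rfl fun i _ => (x.isGds i).length_eq] at h1
  omega

theorem mainTheorem5 :
    (∀ (n m : ℕ), 1 ≤ m → 2 * (m + 1) ≤ n →
      ∀ (V : Fin n → Type*) [∀ i, Finite (V i)] [∀ i, Nonempty (V i)]
        (R : ∀ i, SimpleGraph (V i)) (w : Fin n → ℤ),
        (∀ i, w i = (grundyNumber (R i) : ℤ) - ((m : ℤ) + 1)) →
        ∀ I : Finset (Fin n), (cyclePower n m).IsIndepSet ↑I →
          ∑ i ∈ I, w i = alphaWeight (cyclePower n m) w →
          (2 ≤ I.card →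
            (grundyNumber (xJoin (cyclePower n m) R) : ℤ) =
              alphaWeight (cyclePower n m) w + n) ∧
          (¬ 2 ≤ I.card →
            (grundyNumber (xJoin (cyclePower n m) R) : ℤ) =
              alphaWeightTwo (cyclePower n m) w + n)) ∧
    PolyTimeSolvable CycleJoinInstance.encode CycleJoinInstance.IsSolution := by
  refine ⟨fun n m hm hn V _ _ R w hw I hI hmax => ?_, polyTimeSolvable_cycleJoin⟩
  exact grundyNumber_xJoin_cyclePower n m hm hn V R w hw I hI hmax
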